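/- Let $k$ be an algebraically closed field and let $C$ be a finite-dimensional $k$-algebra of global dimension $2$. All modules are finitely generated right modules, and $D=\operatorname{Hom}_k(-,k)$. Let $E=\operatorname{Ext}^2_C(DC,C)$ with its natural $C$-$C$-bimodule structure, and let $B=C\ltimes E$ be the relation extension of $C$, that is, $B=C\oplus E$ with multiplication $(c,e)(c',e')=(cc',\,ce'+ec')$. Every $C$-module $M$ is regarded as a $B$-module through $m\cdot(c,e)=mc$. A $C$-module $M$ is called tilting if $\operatorname{pd}_C M\le 1$, $\operatorname{Ext}^1_C(M,M)=0$, and there is a short exact sequence $0\to C\to T'\to T''\to 0$ with $T',T''\in\operatorname{add}M$. A $B$-module $M$ is called $\tau_B$-tilting if $\operatorname{Hom}_B(M,\tau_B M)=0$, where $\tau_B$ is the Auslander–Reiten translation of $B$, and the number of pairwise non-isomorphic indecomposable direct summands of $M$ equals the number of isomorphism classes of simple $B$-modules. Let $M$ be a tilting $C$-module. Then $M$ is $\tau_B$-tilting if and only if $\operatorname{id}_C M\le 1$. -/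

import Mathlib

open CategoryTheory CategoryTheory.Abelian

universe u

noncomputable section

namespace TauTilting

/-- Right modules over a ring `Λ`, that is, left modules over the opposite ring. -/
abbrev RightMod (Λ : Type u) [Ring Λ] := ModuleCat.{u} Λᵐᵒᵖ

/-- `Λ` as a right module over itself. -/
abbrev regular (Λ : Type u) [Ring Λ] : RightMod Λ := ModuleCat.of Λᵐᵒᵖ Λ

section Duality

/-- The standard dual `D X = Hom_k(X, k)` of a left `Λ`-module `X`, as a right `Λ`-module:
`(f · a) x = f (a x)`. -/
def Dual (k : Type u) [Field k] (X : Type u) [AddCommGroup X] [Module k X] : Type u :=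
  X →ₗ[k] k

variable (k : Type u) [Field k] (X : Type u) [AddCommGroup X] [Module k X]

instance : AddCommGroup (Dual k X) := inferInstanceAs (AddCommGroup (X →ₗ[k] k))

instance (Λ : Type u) [Ring Λ] [Module Λ X] [SMulCommClass Λ k X] : Module Λᵐᵒᵖ (Dual k X) where
  smul a f := LinearMap.comp (show X →ₗ[k] k from f) (DistribSMul.toLinearMap k X a.unop)
  one_smul f := LinearMap.ext fun x => congrArg (show X →ₗ[k] k from f) (one_smul Λ x)
  mul_smul a b f := LinearMap.ext fun x =>
    congrArg (show X →ₗ[k] k from f) (mul_smul b.unop a.unop x)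
  smul_zero _ := rfl
  smul_add _ _ _ := rfl
  add_smul a b f := LinearMap.ext fun x =>
    (congrArg (show X →ₗ[k] k from f) (add_smul a.unop b.unop x)).trans
      (map_add (show X →ₗ[k] k from f) _ _)
  zero_smul f := LinearMap.ext fun x =>
    (congrArg (show X →ₗ[k] k from f) (zero_smul Λ x)).trans
      (map_zero (show X →ₗ[k] k from f))

end Duality

section HomologicalDimension

/-- The global dimension of `Λ`: the supremum of the projective dimensions of the finitely
generated right `Λ`-modules. -/
def globalDimension (Λ : Type u) [Ring Λ] : WithBot ℕ∞ :=
  ⨆ (M : RightMod Λ) (_ : Module.Finite Λᵐᵒᵖ M), projectiveDimension M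

end HomologicalDimension

section Tilting

variable {Λ : Type u} [Ring Λ]

/-- `X ∈ add T`: `X` is a direct summand of some finite direct sum `T ⊕ ⋯ ⊕ T`. -/
def InAdd (T X : RightMod Λ) : Prop :=
  ∃ n : ℕ, Nonempty (Retract X (ModuleCat.of Λᵐᵒᵖ (Fin n → T)))

structure IsPartialTilting (T : RightMod Λ) : Prop where
  finite : Module.Finite Λᵐᵒᵖ T
  projectiveDimension_le : projectiveDimension T ≤ 1
  ext_self : Subsingleton (Ext T T 1)

/-- A partial tilting module `T` with an exact sequence `0 ⟶ Λ ⟶ T' ⟶ T'' ⟶ 0`, where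
`T', T'' ∈ add T`. -/
structure IsTilting (T : RightMod Λ) : Prop extends IsPartialTilting T where
  coresolution : ∃ S : ShortComplex (RightMod Λ), S.ShortExact ∧
    Nonempty (S.X₁ ≅ regular Λ) ∧ InAdd T S.X₂ ∧ InAdd T S.X₃

end Tilting

section AuslanderReiten

variable {Λ : Type u} [Ring Λ]

/-- A submodule `K` of `P` is superfluous if `N + K = P` implies `N = P`. -/
def IsSuperfluous {P : RightMod Λ} (K : Submodule Λᵐᵒᵖ P) : Prop :=
  ∀ N : Submodule Λᵐᵒᵖ P, N ⊔ K = ⊤ → N = ⊤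

/-- A minimal projective presentation `P₁ ⟶ P₀ ⟶ M ⟶ 0`: an exact sequence in which
`P₀ ⟶ M` and `P₁ ⟶ ker d₀` are projective covers. -/
structure MinimalPresentation (M : RightMod Λ) where
  P₁ : RightMod Λ
  P₀ : RightMod Λ
  d₁ : P₁ ⟶ P₀
  d₀ : P₀ ⟶ M
  finite₁ : Module.Finite Λᵐᵒᵖ P₁
  finite₀ : Module.Finite Λᵐᵒᵖ P₀
  projective₁ : Module.Projective Λᵐᵒᵖ P₁
  projective₀ : Module.Projective Λᵐᵒᵖ P₀
  surjective : Function.Surjective d₀.hom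
  exact : Function.Exact d₁.hom d₀.hom
  superfluous₀ : IsSuperfluous (LinearMap.ker d₀.hom)
  superfluous₁ : IsSuperfluous (LinearMap.ker d₁.hom)

/-- The map `Hom_Λ(P₀, Λ) ⟶ Hom_Λ(P₁, Λ)`, `f ↦ f ∘ d`, of left `Λ`-modules, where `Λ` acts on
these groups through left multiplication on the target. -/
def homRegularMap {P₁ P₀ : RightMod Λ} (d : P₁ ⟶ P₀) :
    (P₀ →ₗ[Λᵐᵒᵖ] Λ) →ₗ[Λ] (P₁ →ₗ[Λᵐᵒᵖ] Λ) where
  toFun f := f.comp d.hom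
  map_add' _ _ := rfl
  map_smul' _ _ := rfl

/-- The transpose `Tr M = coker (Hom_Λ(P₀, Λ) ⟶ Hom_Λ(P₁, Λ))`, a left `Λ`-module. -/
abbrev MinimalPresentation.Transpose {M : RightMod Λ} (p : MinimalPresentation M) : Type u :=
  (p.P₁ →ₗ[Λᵐᵒᵖ] Λ) ⧸ LinearMap.range (homRegularMap p.d₁)

/-- The Auslander–Reiten translate `τ M = D Tr M`, computed from a minimal projective
presentation of `M`. Such presentations are unique up to isomorphism, and hence so is `τ M`. -/
def MinimalPresentation.tau (k : Type u) [Field k] [Algebra k Λ] {M : RightMod Λ}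
    (p : MinimalPresentation M) : RightMod Λ :=
  ModuleCat.of Λᵐᵒᵖ (Dual k p.Transpose)

/-- `M` is `τ`-rigid: `Hom_Λ(M, τ M) = 0`. -/
def IsTauRigid (k : Type u) [Field k] [Algebra k Λ] (M : RightMod Λ) : Prop :=
  ∃ p : MinimalPresentation M, Subsingleton (M ⟶ p.tau k)

/-- The isomorphism classes of indecomposable direct summands of `M`. -/
def indecomposableSummands (M : RightMod Λ) : Set (Quotient (isIsomorphicSetoid (RightMod Λ))) :=
  {c | ∃ X : RightMod Λ, Indecomposable X ∧ Nonempty (Retract X M) ∧ c = Quotient.mk _ X}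

variable (Λ) in
/-- The isomorphism classes of simple right `Λ`-modules. -/
def simpleClasses : Set (Quotient (isIsomorphicSetoid (RightMod Λ))) :=
  {c | ∃ X : RightMod Λ, IsSimpleModule Λᵐᵒᵖ X ∧ c = Quotient.mk _ X}

/-- A `τ`-rigid module is `τ`-tilting if it has as many pairwise non-isomorphic indecomposable
direct summands as there are isomorphism classes of simple modules. -/
structure IsTauTilting (k : Type u) [Field k] [Algebra k Λ] (M : RightMod Λ) : Prop where
  finite : Module.Finite Λᵐᵒᵖ M
  tauRigid : IsTauRigid k M
  card_eq : (indecomposableSummands M).encard = (simpleClasses Λ).encard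

end AuslanderReiten

section RelationExtension

variable (k : Type u) [Field k] (C : Type u) [Ring C] [Algebra k C]

/-- The right `C`-module `DC`. -/
abbrev dualRegular : RightMod C := ModuleCat.of Cᵐᵒᵖ (Dual k C)

/-- Left multiplication by `c` on `C`, an endomorphism of the right module `C`. -/
def leftMul : C →+* End (regular C) where
  toFun c := ModuleCat.ofHom
    { toFun := fun x => c * x
      map_add' := mul_add c
      map_smul' := fun a x => (mul_assoc c x a.unop).symm }
  map_one' := ModuleCat.hom_ext (LinearMap.ext fun x => one_mul x)
  map_mul' a b := ModuleCat.hom_ext (LinearMap.ext fun x => mul_assoc a b x)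
  map_zero' := ModuleCat.hom_ext (LinearMap.ext fun x => zero_mul x)
  map_add' a b := ModuleCat.hom_ext (LinearMap.ext fun x => add_mul a b x)

/-- Left multiplication by `c` on `DC`, `(c f) x = f (x c)`, an endomorphism of the right
module `DC`. -/
def leftMulDual : C →+* End (dualRegular k C) where
  toFun c := ModuleCat.ofHom
    { toFun := fun f => LinearMap.comp (show C →ₗ[k] k from f) (LinearMap.mulRight k c)
      map_add' := fun _ _ => rfl
      map_smul' := fun a f => LinearMap.ext fun x =>
        congrArg (show C →ₗ[k] k from f) (mul_assoc a.unop x c).symm }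
  map_one' := ModuleCat.hom_ext <| LinearMap.ext fun f => LinearMap.ext fun x =>
    congrArg (show C →ₗ[k] k from f) (mul_one x)
  map_mul' a b := ModuleCat.hom_ext <| LinearMap.ext fun f => LinearMap.ext fun x =>
    congrArg (show C →ₗ[k] k from f) (mul_assoc x a b).symm
  map_zero' := ModuleCat.hom_ext <| LinearMap.ext fun f => LinearMap.ext fun x =>
    (congrArg (show C →ₗ[k] k from f) (mul_zero x)).trans (map_zero (show C →ₗ[k] k from f))
  map_add' a b := ModuleCat.hom_ext <| LinearMap.ext fun f => LinearMap.ext fun x =>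
    (congrArg (show C →ₗ[k] k from f) (mul_add x a b)).trans
      (map_add (show C →ₗ[k] k from f) _ _)

/-- The left action of `C` on `Ext²_C(DC, C)`, induced by left multiplication on the second
argument `C`. -/
abbrev extLeftModule : Module C (Ext (dualRegular k C) (regular C) 2) where
  smul c e := e.comp (Ext.mk₀ (leftMul C c)) (add_zero 2)
  one_smul e := by
    change e.comp (Ext.mk₀ (leftMul C 1)) (add_zero 2) = e
    rw [map_one]
    exact Ext.comp_mk₀_id _
  mul_smul a b e := by
    change e.comp (Ext.mk₀ (leftMul C (a * b))) (add_zero 2) =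
      (e.comp (Ext.mk₀ (leftMul C b)) (add_zero 2)).comp (Ext.mk₀ (leftMul C a)) (add_zero 2)
    rw [Ext.comp_assoc_of_third_deg_zero, Ext.mk₀_comp_mk₀, map_mul]
    rfl
  smul_zero c := Ext.zero_comp _ _ (Ext.mk₀ (leftMul C c)) _ _
  smul_add c e e' := Ext.add_comp _ _ (Ext.mk₀ (leftMul C c)) _
  add_smul a b e := by
    change e.comp (Ext.mk₀ (leftMul C (a + b))) (add_zero 2) =
      e.comp (Ext.mk₀ (leftMul C a)) (add_zero 2) + e.comp (Ext.mk₀ (leftMul C b)) (add_zero 2)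
    rw [map_add, Ext.mk₀_add, Ext.comp_add]
  zero_smul e := by
    change e.comp (Ext.mk₀ (leftMul C 0)) (add_zero 2) = 0
    rw [map_zero, Ext.mk₀_zero, Ext.comp_zero]

/-- The right action of `C` on `Ext²_C(DC, C)`, induced by left multiplication on the first
argument `DC`. -/
abbrev extRightModule : Module Cᵐᵒᵖ (Ext (dualRegular k C) (regular C) 2) where
  smul c e := (Ext.mk₀ (leftMulDual k C c.unop)).comp e (zero_add 2)
  one_smul e := by
    change (Ext.mk₀ (leftMulDual k C 1)).comp e (zero_add 2) = e
    rw [map_one]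
    exact Ext.mk₀_id_comp _
  mul_smul a b e := by
    change (Ext.mk₀ (leftMulDual k C (b.unop * a.unop))).comp e (zero_add 2) =
      (Ext.mk₀ (leftMulDual k C a.unop)).comp
        ((Ext.mk₀ (leftMulDual k C b.unop)).comp e (zero_add 2)) (zero_add 2)
    rw [Ext.mk₀_comp_mk₀_assoc, map_mul]
    rfl
  smul_zero c := Ext.comp_zero (Ext.mk₀ (leftMulDual k C c.unop)) _ _ _ _
  smul_add c e e' := Ext.comp_add (Ext.mk₀ (leftMulDual k C c.unop)) _ _ _
  add_smul a b e := by
    change (Ext.mk₀ (leftMulDual k C (a.unop + b.unop))).comp e (zero_add 2) =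
      (Ext.mk₀ (leftMulDual k C a.unop)).comp e (zero_add 2) +
        (Ext.mk₀ (leftMulDual k C b.unop)).comp e (zero_add 2)
    rw [map_add, Ext.mk₀_add, Ext.add_comp]
  zero_smul e := by
    change (Ext.mk₀ (leftMulDual k C 0)).comp e (zero_add 2) = 0
    rw [map_zero, Ext.mk₀_zero, Ext.zero_comp]

theorem ext_smul_comm (a b : C) (e : Ext (dualRegular k C) (regular C) 2) :
    ((Ext.mk₀ (leftMulDual k C b)).comp e (zero_add 2)).comp
        (Ext.mk₀ (leftMul C a)) (add_zero 2) =
      (Ext.mk₀ (leftMulDual k C b)).comp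
        (e.comp (Ext.mk₀ (leftMul C a)) (add_zero 2)) (zero_add 2) := by
  rw [Ext.comp_assoc_of_third_deg_zero]

variable {k C} in
theorem ext_comp_central {X Y : RightMod C} {n : ℕ} (e : Ext X Y n) (r : k) (f : X ⟶ X)
    (g : Y ⟶ Y) (hf : ∀ x, f.hom x = algebraMap k Cᵐᵒᵖ r • x)
    (hg : ∀ y, g.hom y = algebraMap k Cᵐᵒᵖ r • y) :
    e.comp (Ext.mk₀ g) (add_zero n) = (Ext.mk₀ f).comp e (zero_add n) := by
  have hf' : f = r • 𝟙 X :=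
    ModuleCat.hom_ext (LinearMap.ext hf)
  have hg' : g = r • 𝟙 Y :=
    ModuleCat.hom_ext (LinearMap.ext hg)
  have h₁ : Ext.mk₀ f = r • Ext.mk₀ (𝟙 X) := by rw [hf']; exact Ext.mk₀_smul r (𝟙 X)
  have h₂ : Ext.mk₀ g = r • Ext.mk₀ (𝟙 Y) := by rw [hg']; exact Ext.mk₀_smul r (𝟙 Y)
  rw [h₁, h₂, Ext.comp_smul, Ext.smul_comp, Ext.comp_mk₀_id, Ext.mk₀_id_comp]

theorem ext_algebraMap_smul (r : k) (e : Ext (dualRegular k C) (regular C) 2) :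
    e.comp (Ext.mk₀ (leftMul C (algebraMap k C r))) (add_zero 2) =
      (Ext.mk₀ (leftMulDual k C (algebraMap k C r))).comp e (zero_add 2) :=
  ext_comp_central e r _ _
    (fun f => LinearMap.ext fun x =>
      congrArg (show C →ₗ[k] k from f) (Algebra.commutes r x).symm)
    (fun x => Algebra.commutes (A := C) r x)

/-- The `C`-`C`-bimodule `E = Ext²_C(DC, C)`. -/
def ExtBimodule : Type u := Ext (dualRegular k C) (regular C) 2

instance : AddCommGroup (ExtBimodule k C) :=
  inferInstanceAs (AddCommGroup (Ext (dualRegular k C) (regular C) 2))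

instance : Module C (ExtBimodule k C) := extLeftModule k C

instance : Module Cᵐᵒᵖ (ExtBimodule k C) := extRightModule k C

instance : SMulCommClass C Cᵐᵒᵖ (ExtBimodule k C) where
  smul_comm a b e := ext_smul_comm k C a b.unop e

/-- `k` acts on `E` through `k → C`; both actions of `C` give the same result. -/
instance : Module k (ExtBimodule k C) := Module.compHom _ (algebraMap k C)

instance : IsScalarTower k C (ExtBimodule k C) where
  smul_assoc r c e := by
    change (r • c) • e = algebraMap k C r • c • e
    rw [Algebra.smul_def, mul_smul]

instance : IsScalarTower k Cᵐᵒᵖ (ExtBimodule k C) where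
  smul_assoc r c e := by
    have h : ∀ e' : ExtBimodule k C,
        algebraMap k C r • e' = MulOpposite.op (algebraMap k C r) • e' :=
      ext_algebraMap_smul k C r
    change (r • c) • e = algebraMap k C r • c • e
    rw [h, ← mul_smul, Algebra.smul_def]
    rfl

/-- The relation extension `B = C ⋉ Ext²_C(DC, C)`, with multiplication
`(c, e) (c', e') = (c c', c e' + e c')`. -/
abbrev RelationExtension : Type u := TrivSqZeroExt C (ExtBimodule k C)

/-- The standard embedding of right `C`-modules into right `B`-modules, `m (c, e) = m c`. -/
abbrev inflation : RightMod C ⥤ RightMod (RelationExtension k C) :=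
  ModuleCat.restrictScalars
    (RingHom.op (TrivSqZeroExt.fstHom k C (ExtBimodule k C)).toRingHom)

end RelationExtension

end TauTilting

end

/-! Global dimension 2 makes `Ext²_C(DC, -)` right exact, so it is `- ⊗_C E`. It also makes `id_C M
≤ 1` equivalent to `Ext²_C(DC, M) = 0` (`injectiveDimension_le_one_iff`). The tensor product is
never formed: `extPairing` plays the role of `M × E → M ⊗_C E`, `exists_extPairing_sum` says that it
spans, and `balanced_eq_zero` says that every balanced map on `M × E` vanishes once `Ext²_C(DC, M) =
0`.

On the other side, `Hom_B(M, τ_B M)` is dual to the cokernel of `Hom(P₀, M) → Hom(P₁, M)` for a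
minimal presentation over `B`. Hence `M` is `τ_B`-rigid exactly when every map `P₁ → M` extends
along `d₁`.

If `M` is `τ_B`-rigid, a nonzero linear form on `Ext²_C(DC, M)` gives a nonzero balanced map `β : M
× E → DC`, that is, a `B`-module structure on `M × DC` in which `E` sends `M` to `DC` by `β`. Since
the tilting module `M` generates the injective `DC`, maps `P₁ → DC` extend to `P₀` as well, and this
forces `β = 0` (`subsingleton_ext_two_of_isTauRigid`).

Conversely, let `Ext²_C(DC, M) = 0` and let `X` be a quotient of `M`. A map `ker d₀ → X` induces a
balanced map on `M × E`, so it vanishes on `P₀ E`. It then extends to `P₀` because `Ext¹_C(M, X) =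
0`, and minimality of the presentation yields rigidity (`isTauRigid_inflation`).

It remains to count. Inflation matches simple modules and indecomposable summands over `C` and `B`,
so the equality needed is that over `C`. Both inequalities are linear algebra with functions
additive on short exact sequences: Euler forms of the summands against the simples
(`encard_indecomposableSummands_le`), and `dim Hom(P, -)` for projective covers `P` of the simples
against the summands (`IsTilting.encard_simpleClasses_le`). -/

noncomputable section

namespace TauTilting

/-! ### Lifting and vanishing from the long exact sequences of `Ext` -/

section ExtVanishing

open Ext

variable {𝒜 : Type*} [Category 𝒜] [Abelian 𝒜] [HasExt 𝒜] {S : ShortComplex 𝒜}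

theorem exists_lift_of_subsingleton_ext (hS : S.ShortExact) {T : 𝒜}
    (h : Subsingleton (Ext T S.X₁ 1)) (f : T ⟶ S.X₃) : ∃ g : T ⟶ S.X₂, g ≫ S.g = f := by
  obtain ⟨x, hx⟩ := covariant_sequence_exact₃ T hS (mk₀ f) (zero_add 1) (Subsingleton.elim _ _)
  obtain ⟨g, rfl⟩ := (mk₀_bijective T S.X₂).2 x
  rw [mk₀_comp_mk₀] at hx
  exact ⟨g, (mk₀_bijective T S.X₃).1 hx⟩

theorem exists_extension_of_subsingleton_ext (hS : S.ShortExact) {Y : 𝒜}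
    (h : Subsingleton (Ext S.X₃ Y 1)) (f : S.X₁ ⟶ Y) : ∃ g : S.X₂ ⟶ Y, S.f ≫ g = f := by
  obtain ⟨x, hx⟩ := contravariant_sequence_exact₁ hS Y (mk₀ f) (add_zero 1)
    (Subsingleton.elim _ _)
  obtain ⟨g, rfl⟩ := (mk₀_bijective S.X₂ Y).2 x
  rw [mk₀_comp_mk₀] at hx
  exact ⟨g, (mk₀_bijective S.X₁ Y).1 hx⟩

theorem subsingleton_of_forall_eq_zero {X Y : 𝒜} {n : ℕ} (h : ∀ e : Ext X Y n, e = 0) :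
    Subsingleton (Ext X Y n) := ⟨fun a b => (h a).trans (h b).symm⟩

theorem subsingleton_ext_one_of_lift (hS : S.ShortExact) {T : 𝒜}
    (h : Subsingleton (Ext T S.X₂ 1)) (hl : ∀ f : T ⟶ S.X₃, ∃ g : T ⟶ S.X₂, g ≫ S.g = f) :
    Subsingleton (Ext T S.X₁ 1) := by
  refine subsingleton_of_forall_eq_zero fun e => ?_
  obtain ⟨x, rfl⟩ := covariant_sequence_exact₁ T hS e (Subsingleton.elim _ _) (zero_add 1)
  obtain ⟨f, rfl⟩ := (mk₀_bijective T S.X₃).2 x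
  obtain ⟨g, rfl⟩ := hl f
  rw [← mk₀_comp_mk₀, comp_assoc_of_second_deg_zero,
    hS.comp_extClass, comp_zero]

theorem subsingleton_ext_X₂ (hS : S.ShortExact) {T : 𝒜} {n : ℕ}
    (h₁ : Subsingleton (Ext T S.X₁ n)) (h₃ : Subsingleton (Ext T S.X₃ n)) :
    Subsingleton (Ext T S.X₂ n) := by
  refine subsingleton_of_forall_eq_zero fun e => ?_
  obtain ⟨x, rfl⟩ := covariant_sequence_exact₂ T hS e (Subsingleton.elim _ _)
  rw [Subsingleton.elim x 0, zero_comp]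

theorem subsingleton_ext_X₃ (hS : S.ShortExact) {T : 𝒜} {n : ℕ}
    (h₂ : Subsingleton (Ext T S.X₂ n)) (h₁ : Subsingleton (Ext T S.X₁ (n + 1))) :
    Subsingleton (Ext T S.X₃ n) := by
  refine subsingleton_of_forall_eq_zero fun e => ?_
  obtain ⟨x, rfl⟩ := covariant_sequence_exact₃ T hS e rfl (Subsingleton.elim _ _)
  rw [Subsingleton.elim x 0, zero_comp]

theorem exists_ext_lift (hS : S.ShortExact) {T : 𝒜} {n : ℕ}
    (h₁ : Subsingleton (Ext T S.X₁ (n + 1))) (e : Ext T S.X₃ n) :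
    ∃ e' : Ext T S.X₂ n, e'.comp (mk₀ S.g) (add_zero n) = e :=
  covariant_sequence_exact₃ T hS e rfl (Subsingleton.elim _ _)

theorem subsingleton_ext_of_X₁ (hS : S.ShortExact) {Y : 𝒜} {n : ℕ}
    (h₂ : Subsingleton (Ext S.X₂ Y n)) (h₃ : Subsingleton (Ext S.X₃ Y (n + 1))) :
    Subsingleton (Ext S.X₁ Y n) := by
  refine subsingleton_of_forall_eq_zero fun e => ?_
  obtain ⟨x, rfl⟩ := contravariant_sequence_exact₁ hS Y e (add_comm 1 n)
    (Subsingleton.elim _ _)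
  rw [Subsingleton.elim x 0, comp_zero]

theorem subsingleton_ext_of_retract_left {X X' Y : 𝒜} (r : Retract X' X) {n : ℕ}
    (h : Subsingleton (Ext X Y n)) : Subsingleton (Ext X' Y n) := by
  refine subsingleton_of_forall_eq_zero fun e => ?_
  rw [← mk₀_id_comp e, ← r.retract, ← mk₀_comp_mk₀_assoc,
    Subsingleton.elim ((mk₀ r.r).comp e _) 0, comp_zero]

end ExtVanishing

/-! ### Finite powers and standard short exact sequences of modules -/

section Powers

variable {A : Type u} [Ring A]

/-- The `n`-th power of a module. -/
abbrev power (X : ModuleCat.{u} A) (n : ℕ) : ModuleCat.{u} A := ModuleCat.of A (Fin n → X)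

def powerProj (X : ModuleCat.{u} A) (n : ℕ) (i : Fin n) : power X n ⟶ X :=
  ModuleCat.ofHom (LinearMap.proj i)

def powerIncl (X : ModuleCat.{u} A) (n : ℕ) (i : Fin n) : X ⟶ power X n :=
  ModuleCat.ofHom (LinearMap.single A (fun _ => X) i)

theorem sum_powerProj_powerIncl (X : ModuleCat.{u} A) (n : ℕ) :
    ∑ i, powerProj X n i ≫ powerIncl X n i = 𝟙 (power X n) := by
  ext x
  simp [powerProj, powerIncl, ModuleCat.hom_sum]

theorem subsingleton_ext_power_right {X Y : ModuleCat.{u} A} {n : ℕ} (m : ℕ)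
    (h : Subsingleton (Ext X Y n)) : Subsingleton (Ext X (power Y m) n) := by
  refine subsingleton_of_forall_eq_zero fun e => ?_
  rw [← Ext.comp_mk₀_id e, ← sum_powerProj_powerIncl, Ext.mk₀_sum, Ext.comp_sum]
  refine Finset.sum_eq_zero fun i _ => ?_
  rw [← Ext.mk₀_comp_mk₀, ← Ext.comp_assoc_of_third_deg_zero,
    Subsingleton.elim (e.comp (Ext.mk₀ _) _) 0, Ext.zero_comp]

theorem subsingleton_ext_power_left {X Y : ModuleCat.{u} A} {n : ℕ} (m : ℕ)
    (h : Subsingleton (Ext X Y n)) : Subsingleton (Ext (power X m) Y n) := by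
  refine subsingleton_of_forall_eq_zero fun e => ?_
  rw [← Ext.mk₀_id_comp e, ← sum_powerProj_powerIncl, Ext.mk₀_sum, Ext.sum_comp]
  refine Finset.sum_eq_zero fun i _ => ?_
  rw [← Ext.mk₀_comp_mk₀_assoc,
    Subsingleton.elim ((Ext.mk₀ _).comp e _) 0, Ext.comp_zero]

end Powers

section Concrete

variable {A : Type u} [Ring A]

/-- The short exact sequence `0 ⟶ N ⟶ X ⟶ X / N ⟶ 0`. -/
abbrev quotientComplex {X : ModuleCat.{u} A} (N : Submodule A X) :
    ShortComplex (ModuleCat.{u} A) where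
  X₁ := ModuleCat.of A N
  X₂ := X
  X₃ := ModuleCat.of A (X ⧸ N)
  f := ModuleCat.ofHom N.subtype
  g := ModuleCat.ofHom N.mkQ
  zero := by ext x; simp

theorem quotientComplex_shortExact {X : ModuleCat.{u} A} (N : Submodule A X) :
    (quotientComplex N).ShortExact :=
  ModuleCat.shortComplex_shortExact _ (LinearMap.exact_subtype_mkQ N) N.injective_subtype
    N.mkQ_surjective

/-- The short exact sequence `0 ⟶ ker f ⟶ X ⟶ Y ⟶ 0` of an epimorphism. -/
abbrev kerComplex {X Y : ModuleCat.{u} A} (f : X ⟶ Y) : ShortComplex (ModuleCat.{u} A) where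
  X₁ := ModuleCat.of A (LinearMap.ker f.hom)
  X₂ := X
  X₃ := Y
  f := ModuleCat.ofHom (LinearMap.ker f.hom).subtype
  g := f
  zero := by ext x; simp

theorem kerComplex_shortExact {X Y : ModuleCat.{u} A} (f : X ⟶ Y)
    (hf : Function.Surjective f.hom) : (kerComplex f).ShortExact :=
  ModuleCat.shortComplex_shortExact _ (LinearMap.exact_subtype_ker_map f.hom)
    (LinearMap.ker f.hom).injective_subtype hf

theorem exists_power_surjective (X : ModuleCat.{u} A) [Module.Finite A X] :
    ∃ (n : ℕ) (f : power (ModuleCat.of A A) n ⟶ X), Function.Surjective f.hom := by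
  obtain ⟨n, f, hf⟩ := Module.Finite.exists_fin' A X
  exact ⟨n, ModuleCat.ofHom f, hf⟩

end Concrete

/-! ### `τ`-rigidity as an extension property of presentations -/

section TauRigid

open scoped ModuleCat

variable {Λ : Type u} [Ring Λ]

theorem exists_dual_basis (P : RightMod Λ) (hf : Module.Finite Λᵐᵒᵖ P)
    (hp : Module.Projective Λᵐᵒᵖ P) :
    ∃ (n : ℕ) (x : Fin n → P) (f : Fin n → (P →ₗ[Λᵐᵒᵖ] Λ)),
      ∀ p : P, ∑ i, MulOpposite.op (f i p) • x i = p := by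
  obtain ⟨n, π, ι, -, -, h⟩ := Module.Finite.exists_comp_eq_id_of_projective Λᵐᵒᵖ P
  refine ⟨n, fun i => π (Pi.single i 1), fun i =>
    { toFun := fun p => (ι p i).unop
      map_add' := fun a b => by simp
      map_smul' := fun a b => by simp }, fun p => ?_⟩
  have h' := LinearMap.congr_fun h p
  simp only [LinearMap.comp_apply, LinearMap.id_apply] at h'
  conv_rhs => rw [← h', LinearMap.pi_apply_eq_sum_univ π (ι p)]
  simp only [LinearMap.coe_mk, AddHom.coe_mk, MulOpposite.op_unop]
  refine Finset.sum_congr rfl fun i _ => ?_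
  congr 2
  ext j
  simp [Pi.single_apply, eq_comm]

variable (k : Type u) [Field k] [Algebra k Λ]

/-- The homomorphism `p ↦ m f(p)` for `m ∈ M` and `f : P ⟶ Λ`. -/
def rankOne {P M : RightMod Λ} (m : M) (f : P →ₗ[Λᵐᵒᵖ] Λ) : P →ₗ[Λᵐᵒᵖ] M where
  toFun p := MulOpposite.op (f p) • m
  map_add' a b := by simp [add_smul]
  map_smul' a b := by simp [mul_smul]

/-- Half of the adjunction `Hom(M, D Hom(P, Λ)) = D(M ⊗ Hom(P, Λ)) = D Hom(P, M)`. When `R` is the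
image of `Hom(P₀, Λ)`, the resulting form is an element of `τ M`. -/
def tauEval {P M : RightMod Λ} (R : Submodule Λ (P →ₗ[Λᵐᵒᵖ] Λ))
    (θ : (P →ₗ[Λᵐᵒᵖ] M) →ₗ[k] k) (hθ : ∀ m : M, ∀ f ∈ R, θ (rankOne m f) = 0) (m : M) :
    ((P →ₗ[Λᵐᵒᵖ] Λ) ⧸ R) →ₗ[k] k :=
  let F : ((P →ₗ[Λᵐᵒᵖ] Λ) ⧸ R) →+ k :=
    QuotientAddGroup.lift R.toAddSubgroup
      { toFun := fun f => θ (rankOne m f)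
        map_zero' := by
          rw [← map_zero θ]; congr 1; ext p; simp [rankOne]
        map_add' := fun f g => by
          rw [← map_add]; congr 1; ext p; simp [rankOne, add_smul] } (fun f hf => hθ m f hf)
  { toFun := F
    map_add' := F.map_add
    map_smul' := fun r q => by
      obtain ⟨f, rfl⟩ := Submodule.Quotient.mk_surjective R q
      change θ (rankOne m (r • f)) = r • θ (rankOne m f)
      rw [← map_smul]
      congr 1
      ext p
      simp only [rankOne, LinearMap.coe_mk, AddHom.coe_mk, LinearMap.smul_apply,
        MulOpposite.op_smul, smul_assoc] }

/-- If `g` did not extend, a linear form `θ` could vanish on all extendable maps but not on `g`.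
Then `m ↦ (f ↦ θ (m f(-)))` is a homomorphism `M ⟶ τ M`, hence zero, so `θ` kills all rank-one maps.
These span `Hom(P₁, M)` because `P₁` has a finite dual basis. -/
theorem forall_exists_extension_of_subsingleton_hom_tau {M : RightMod Λ}
    (p : MinimalPresentation M) (h : Subsingleton (M ⟶ p.tau k)) (g : p.P₁ ⟶ M) :
    ∃ h : p.P₀ ⟶ M, p.d₁ ≫ h = g := by
  by_contra hg
  let W : Submodule k (p.P₁ →ₗ[Λᵐᵒᵖ] M) :=
    LinearMap.range (LinearMap.lcomp k M p.d₁.hom :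
      (p.P₀ →ₗ[Λᵐᵒᵖ] M) →ₗ[k] (p.P₁ →ₗ[Λᵐᵒᵖ] M))
  have hW : g.hom ∉ W := by
    rintro ⟨f, hf⟩
    exact hg ⟨ModuleCat.ofHom f, ModuleCat.hom_ext hf⟩
  obtain ⟨θ, hθg, hθW⟩ := Submodule.exists_le_ker_of_notMem hW
  have hθ : ∀ m : M, ∀ f ∈ LinearMap.range (homRegularMap p.d₁), θ (rankOne m f) = 0 := by
    rintro m _ ⟨f, rfl⟩
    exact hθW ⟨rankOne m f, rfl⟩
  let φ : M ⟶ p.tau k := ModuleCat.ofHom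
    { toFun := fun m => (show Dual k p.Transpose from tauEval k _ θ hθ m)
      map_add' := fun m m' => LinearMap.ext fun q => by
        obtain ⟨f, rfl⟩ := Submodule.Quotient.mk_surjective _ q
        change θ _ = θ _ + θ _
        rw [← map_add]; congr 1; ext x; simp [rankOne]
      map_smul' := fun a m => LinearMap.ext fun q => by
        obtain ⟨f, rfl⟩ := Submodule.Quotient.mk_surjective _ q
        change θ _ = θ (rankOne m (a.unop • f))
        congr 1; ext x; simp [rankOne, mul_smul] }
  have hφ : ∀ m f, θ (rankOne m f) = 0 := fun m f => by
    have h0 : φ = 0 := Subsingleton.elim _ _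
    exact LinearMap.congr_fun (show tauEval k _ θ hθ m = 0 from
      congrArg (fun ψ : M ⟶ p.tau k => ψ.hom m) h0) (Submodule.Quotient.mk f)
  apply hθg
  obtain ⟨n, x, f, hx⟩ := exists_dual_basis p.P₁ p.finite₁ p.projective₁
  have : g.hom = ∑ i, rankOne (g.hom (x i)) (f i) := by
    ext y
    conv_lhs => rw [← hx y, map_sum]
    simp [rankOne]
  rw [this, map_sum]
  exact Finset.sum_eq_zero fun i _ => hφ _ _

/-- A dual basis of `P₁` shows that `φ m` evaluated at `f` depends only on the rank-one map `m
f(-)`. If this map is `h ∘ d₁`, a dual basis `(y, y')` of `P₀` rewrites the value as a sum of terms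
`φ (h y)` evaluated at `y' ∘ d₁`, and `y' ∘ d₁` is zero in the transpose. -/
theorem subsingleton_hom_tau_of_forall_exists_extension {M : RightMod Λ}
    (p : MinimalPresentation M) (h : ∀ g : p.P₁ ⟶ M, ∃ h : p.P₀ ⟶ M, p.d₁ ≫ h = g) :
    Subsingleton (M ⟶ p.tau k) := by
  suffices H : ∀ φ : M →ₗ[Λᵐᵒᵖ] Dual k p.Transpose, ∀ m f,
      (show p.Transpose →ₗ[k] k from φ m) (Submodule.Quotient.mk f) = 0 by
    have H' : ∀ φ : M ⟶ p.tau k, φ = 0 := fun φ => by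
      ext m
      refine LinearMap.ext fun q => ?_
      obtain ⟨f, rfl⟩ := Submodule.Quotient.mk_surjective _ q
      exact H φ.hom m f
    exact ⟨fun a b => (H' a).trans (H' b).symm⟩
  intro φ m f
  obtain ⟨ev, hsmul, hev⟩ : ∃ ev : M →+ p.Transpose →+ k,
      (∀ (a : Λ) (m : M) (q : p.Transpose), ev (MulOpposite.op a • m) q = ev m (a • q)) ∧
        ∀ m q, (show p.Transpose →ₗ[k] k from φ m) q = ev m q := by
    refine ⟨{ toFun := fun m => (show p.Transpose →ₗ[k] k from φ m).toAddMonoidHom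
              map_zero' := by rw [map_zero]; rfl
              map_add' := fun a b => by rw [map_add]; rfl }, fun a m q => ?_, fun m q => rfl⟩
    change (show p.Transpose →ₗ[k] k from φ (MulOpposite.op a • m)) q =
      (show p.Transpose →ₗ[k] k from φ m) (a • q)
    rw [map_smul]
    rfl
  rw [hev]
  obtain ⟨n, x, x', hx⟩ := exists_dual_basis p.P₁ p.finite₁ p.projective₁
  have key : ∀ (m : M) (f : p.P₁ →ₗ[Λᵐᵒᵖ] Λ), ev m (Submodule.Quotient.mk f) =
        ∑ i, ev (MulOpposite.op (f (x i)) • m) (Submodule.Quotient.mk (x' i)) := fun m f => by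
    have hf : f = ∑ i, f (x i) • x' i := by
      ext y
      conv_lhs => rw [← hx y, map_sum]
      simp
    have h1 : (Submodule.Quotient.mk f : p.Transpose) =
        ∑ i, f (x i) • (Submodule.Quotient.mk (x' i) : p.Transpose) := by
      conv_lhs => rw [hf]
      exact map_sum (Submodule.mkQ _) _ _
    rw [h1, map_sum]
    exact Finset.sum_congr rfl fun i _ => (hsmul _ _ _).symm
  obtain ⟨h, hh⟩ := h (ModuleCat.ofHom (rankOne m f))
  obtain ⟨l, y, y', hy⟩ := exists_dual_basis p.P₀ p.finite₀ p.projective₀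
  have h0 : ∀ (m : M) (f : p.P₀ →ₗ[Λᵐᵒᵖ] Λ),
      ev m (Submodule.Quotient.mk (f.comp p.d₁.hom)) = 0 := fun m f => by
    have : (Submodule.Quotient.mk (f.comp p.d₁.hom) : p.Transpose) = 0 :=
      (Submodule.Quotient.mk_eq_zero _).2 (LinearMap.mem_range.2 ⟨f, rfl⟩)
    rw [this, map_zero]
  have h1 : ∑ j, ev (h.hom (y j)) (Submodule.Quotient.mk ((y' j).comp p.d₁.hom)) = 0 :=
    Finset.sum_eq_zero fun j _ => h0 _ _
  rw [Finset.sum_congr rfl fun j _ => key (h.hom (y j)) ((y' j).comp p.d₁.hom),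
    Finset.sum_comm] at h1
  rw [key, ← h1]
  refine Finset.sum_congr rfl fun i _ => ?_
  have h2 : MulOpposite.op (f (x i)) • m =
      ∑ j, MulOpposite.op (y' j (p.d₁.hom (x i))) • h.hom (y j) := by
    have := congrArg (fun ψ : p.P₁ ⟶ M => ψ.hom (x i)) hh
    simp only [ModuleCat.hom_comp, LinearMap.comp_apply, ModuleCat.hom_ofHom] at this
    rw [← hy (p.d₁.hom (x i)), map_sum] at this
    simpa [rankOne] using this.symm
  rw [h2, map_sum, AddMonoidHom.finsetSum_apply]
  rfl

end TauRigid

/-! ### Projective covers and minimal presentations -/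

section ProjectiveCover

/-- A projective `P` of least length that surjects onto `X` works. If `N + ker f = P`, then `f`
lifts through `N`, giving an endomorphism `ψ` over `X` with image in `N`. By Fitting's lemma a high
power of `ψ` has a direct summand of `P` as its image; it still surjects onto `X`, so it is all of
`P`. -/
theorem exists_projective_cover {A : Type u} [Ring A] [IsArtinianRing A] [IsNoetherianRing A]
    (X : ModuleCat.{u} A) [Module.Finite A X] :
    ∃ (P : ModuleCat.{u} A) (f : P ⟶ X), Module.Finite A P ∧ Module.Projective A P ∧
      Function.Surjective f.hom ∧
      ∀ N : Submodule A P, N ⊔ LinearMap.ker f.hom = ⊤ → N = ⊤ := by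
  let S : Set ℕ∞ := {l | ∃ (P : ModuleCat.{u} A) (f : P ⟶ X), Module.Finite A P ∧
    Module.Projective A P ∧ Function.Surjective f.hom ∧ Module.length A P = l}
  have hS : S.Nonempty := by
    obtain ⟨n, f, hf⟩ := exists_power_surjective X
    exact ⟨_, _, f, inferInstance, inferInstance, hf, rfl⟩
  obtain ⟨P, f, hP, hP', hf, hl⟩ := wellFounded_lt.min_mem S hS
  refine ⟨P, f, hP, hP', hf, fun N hN => ?_⟩
  have hq : Function.Surjective (f.hom ∘ₗ N.subtype) := by
    intro x
    obtain ⟨p, rfl⟩ := hf x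
    obtain ⟨a, ha, b, hb, rfl⟩ := Submodule.mem_sup.1 (hN ▸ Submodule.mem_top : p ∈ N ⊔ _)
    exact ⟨⟨a, ha⟩, by simp [LinearMap.mem_ker.1 hb]⟩
  obtain ⟨φ, hφ⟩ := Module.projective_lifting_property _ f.hom hq
  let ψ : Module.End A P := N.subtype ∘ₗ φ
  have hψ : ∀ n : ℕ, f.hom ∘ₗ (ψ ^ n) = f.hom := by
    intro n
    induction n with
    | zero => rfl
    | succ n ih => rw [pow_succ, Module.End.mul_eq_comp, ← LinearMap.comp_assoc, ih]; exact hφ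
  obtain ⟨n, hn⟩ := Filter.eventually_atTop.1
    (LinearMap.eventually_isCompl_ker_pow_range_pow ψ)
  -- The exponent `n + 1` is positive, so the range also lies in the image of `ψ`, hence in `N`.
  let R : Submodule A P := LinearMap.range (ψ ^ (n + 1))
  have hR : Module.Projective A R :=
    Module.Projective.of_split R.subtype (R.projectionOnto _ (hn (n + 1) (by lia)).symm)
      (LinearMap.ext fun x => Submodule.projectionOnto_apply_left _ x)
  have hRX : Function.Surjective (f.hom ∘ₗ R.subtype) := by
    intro x
    obtain ⟨p, rfl⟩ := hf x
    exact ⟨⟨_, LinearMap.mem_range_self (ψ ^ (n + 1)) p⟩, LinearMap.congr_fun (hψ (n + 1)) p⟩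
  have hRt : R = ⊤ := by
    by_contra hne
    have h1 : Module.length A R < Module.length A P :=
      Submodule.length_lt hne
    refine wellFounded_lt.not_lt_min S (x := Module.length A R)
      ⟨ModuleCat.of A R, ModuleCat.ofHom (f.hom ∘ₗ R.subtype), inferInstance, hR, hRX, rfl⟩ ?_
    rwa [← hl]
  rw [eq_top_iff, ← hRt]
  rintro _ ⟨p, rfl⟩
  rw [pow_succ', Module.End.mul_apply]
  exact (φ _).2

theorem nonempty_minimalPresentation {Λ : Type u} [Ring Λ] [IsArtinianRing Λᵐᵒᵖ]
    [IsNoetherianRing Λᵐᵒᵖ] (M : RightMod Λ) [Module.Finite Λᵐᵒᵖ M] :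
    Nonempty (MinimalPresentation M) := by
  obtain ⟨P₀, d₀, h₀, h₀', hs₀, hm₀⟩ := exists_projective_cover M
  obtain ⟨P₁, f, h₁, h₁', hs₁, hm₁⟩ :=
    exists_projective_cover (ModuleCat.of Λᵐᵒᵖ (LinearMap.ker d₀.hom))
  refine ⟨⟨P₁, P₀, ModuleCat.ofHom ((LinearMap.ker d₀.hom).subtype ∘ₗ f.hom), d₀, h₁, h₀, h₁', h₀',
    hs₀, ?_, hm₀, ?_⟩⟩
  · rw [LinearMap.exact_iff, ModuleCat.hom_ofHom, LinearMap.range_comp,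
      LinearMap.range_eq_top.2 hs₁, Submodule.map_top, Submodule.range_subtype]
  · intro N hN
    apply hm₁
    rwa [ModuleCat.hom_ofHom, LinearMap.ker_comp_of_ker_eq_bot _ (Submodule.ker_subtype _)] at hN

/-- With `K = ker d₁`, the map `g` induces `ker d₀ → M / g(K)`. Extending this to `P₀` and lifting
to `w : P₀ → M` leaves a difference `g - w d₁` with values in `g(K)`. As it agrees with `g` on `K`,
its kernel together with `K` is all of `P₁`; superfluity of `K` makes it zero. -/
theorem MinimalPresentation.forall_exists_extension {Λ : Type u} [Ring Λ] {M : RightMod Λ}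
    (p : MinimalPresentation M)
    (h : ∀ (X : RightMod Λ) (q : M ⟶ X), Function.Surjective q.hom →
      ∀ u : LinearMap.ker p.d₀.hom →ₗ[Λᵐᵒᵖ] X, ∃ v : p.P₀ →ₗ[Λᵐᵒᵖ] X,
        v ∘ₗ (LinearMap.ker p.d₀.hom).subtype = u)
    (g : p.P₁ ⟶ M) : ∃ h : p.P₀ ⟶ M, p.d₁ ≫ h = g := by
  have := p.projective₀
  let K := LinearMap.ker p.d₁.hom
  let N : Submodule Λᵐᵒᵖ M := K.map g.hom
  have hd : ∀ x, p.d₁.hom x ∈ LinearMap.ker p.d₀.hom := fun x => (p.exact _).2 ⟨x, rfl⟩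
  let d : p.P₁ →ₗ[Λᵐᵒᵖ] LinearMap.ker p.d₀.hom := p.d₁.hom.codRestrict _ hd
  have hds : Function.Surjective d := by
    rintro ⟨y, hy⟩
    obtain ⟨x, rfl⟩ := (p.exact _).1 hy
    exact ⟨x, rfl⟩
  have hdk : LinearMap.ker d = K := LinearMap.ker_codRestrict _ _ _
  let l : (p.P₁ ⧸ K) →ₗ[Λᵐᵒᵖ] M ⧸ N := K.liftQ (N.mkQ ∘ₗ g.hom) (fun x hx => by
    simpa using Submodule.mem_map_of_mem hx)
  let e : (p.P₁ ⧸ K) ≃ₗ[Λᵐᵒᵖ] LinearMap.ker p.d₀.hom :=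
    (Submodule.quotEquivOfEq _ _ hdk.symm).trans (d.quotKerEquivOfSurjective hds)
  let u : LinearMap.ker p.d₀.hom →ₗ[Λᵐᵒᵖ] M ⧸ N := l ∘ₗ e.symm.toLinearMap
  have hu : ∀ x, u (d x) = N.mkQ (g.hom x) := fun x => by
    have : e.symm (d x) = K.mkQ x := by
      rw [LinearEquiv.symm_apply_eq]; rfl
    exact congrArg l this
  obtain ⟨v, hv⟩ := h (ModuleCat.of Λᵐᵒᵖ (M ⧸ N)) (ModuleCat.ofHom N.mkQ) N.mkQ_surjective u
  obtain ⟨w, hw⟩ := Module.projective_lifting_property N.mkQ v N.mkQ_surjective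
  have hw' : ∀ x, g.hom x - w (p.d₁.hom x) ∈ N := fun x => by
    rw [← Submodule.Quotient.eq]
    change N.mkQ _ = N.mkQ _
    rw [← hu, ← hv, ← hw]
    rfl
  let g' : p.P₁ →ₗ[Λᵐᵒᵖ] M := g.hom - w ∘ₗ p.d₁.hom
  have hg' : LinearMap.ker g' ⊔ K = ⊤ := by
    rw [eq_top_iff]
    intro x _
    obtain ⟨y, hy, hyx⟩ := hw' x
    refine Submodule.mem_sup.2 ⟨x - y, ?_, y, hy, by simp⟩
    have : p.d₁.hom y = 0 := hy
    simp [g', this, hyx]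
  refine ⟨ModuleCat.ofHom w, ?_⟩
  have h0 := p.superfluous₁ _ hg'
  ext x
  have : g' x = 0 := by
    rw [← LinearMap.mem_ker, h0]; trivial
  exact (sub_eq_zero.1 this).symm

end ProjectiveCover

/-! ### Finite-dimensionality of `Hom` and `Ext` -/

section FiniteDimensional

open scoped ModuleCat

variable (k : Type u) [Field k] {A : Type u} [Ring A] [Algebra k A] [FiniteDimensional k A]

theorem finite_restrictScalars (X : ModuleCat.{u} A) [Module.Finite A X] :
    Module.Finite k X := Module.Finite.trans A X

theorem finite_hom (X Y : ModuleCat.{u} A) [Module.Finite A X] [Module.Finite A Y] :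
    Module.Finite k (X ⟶ Y) := by
  have := finite_restrictScalars k X
  have := finite_restrictScalars k Y
  let f : (X ⟶ Y) →ₗ[k] (X →ₗ[k] Y) :=
    { toFun := fun g => g.hom.restrictScalars k
      map_add' := fun _ _ => rfl
      map_smul' := fun _ _ => rfl }
  exact Module.Finite.of_injective f fun a b h =>
    ModuleCat.hom_ext (LinearMap.ext fun x => LinearMap.congr_fun h x)

theorem finite_ext (X Y : ModuleCat.{u} A) [hX : Module.Finite A X] [Module.Finite A Y] (n : ℕ) :
    Module.Finite k (Ext X Y n) := by
  have := IsNoetherianRing.of_finite k A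
  induction n generalizing X with
  | zero =>
    have := finite_hom k X Y
    exact Module.Finite.equiv (Ext.linearEquiv₀ (R := k) (X := X) (Y := Y)).symm
  | succ n ih =>
    obtain ⟨m, f, hf⟩ := exists_power_surjective X
    have hS := kerComplex_shortExact f hf
    have := ih (kerComplex f).X₁
    let g : Ext (kerComplex f).X₁ Y n →ₗ[k] Ext X Y (n + 1) :=
      { toFun := fun e => hS.extClass.comp e (add_comm 1 n)
        map_add' := fun a b => Ext.comp_add _ _ _ _
        map_smul' := fun r a => Ext.comp_smul _ _ _ _ }
    refine Module.Finite.of_surjective g fun e => ?_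
    have : Projective (kerComplex f).X₂ :=
      inferInstanceAs (Projective (ModuleCat.of A (Fin m → ModuleCat.of A A)))
    exact Ext.contravariant_sequence_exact₃ hS Y e (Ext.eq_zero_of_projective _) (add_comm 1 n)

end FiniteDimensional

/-! ### Injective dimension and the cogenerator `DC` -/

section InjectiveDimension

variable {A : Type u} [Ring A]

/-- Baer's criterion only tests the cyclic modules `A / I`. -/
theorem injective_of_forall_subsingleton_ext_one (N : ModuleCat.{u} A)
    (h : ∀ X : ModuleCat.{u} A, Module.Finite A X → Subsingleton (Ext X N 1)) : Injective N := by
  have hb : Module.Baer A N := fun I g => by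
    obtain ⟨f, hf⟩ := exists_extension_of_subsingleton_ext
      (quotientComplex_shortExact (X := ModuleCat.of A A) I)
      (h (ModuleCat.of A (A ⧸ I)) inferInstance) (ModuleCat.ofHom g)
    exact ⟨f.hom, fun x hx =>
      congrArg (fun φ : (quotientComplex (X := ModuleCat.of A A) I).X₁ ⟶ N => φ.hom ⟨x, hx⟩) hf⟩
  have := hb.injective
  exact Module.injective_object_of_injective_module A N

theorem hasInjectiveDimensionLT_two_of_forall_subsingleton_ext_two (M : ModuleCat.{u} A)
    (h : ∀ X : ModuleCat.{u} A, Module.Finite A X → Subsingleton (Ext X M 2)) :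
    HasInjectiveDimensionLT M 2 := by
  obtain ⟨⟨J, hJ, f, hf⟩⟩ := EnoughInjectives.presentation M
  have hS : (ShortComplex.mk f (Limits.cokernel.π f) (Limits.cokernel.condition f)).ShortExact :=
    { exact := ShortComplex.exact_cokernel f }
  refine hS.hasInjectiveDimensionLT_X₁ 1 ?_ ?_
  · rw [← injective_iff_hasInjectiveDimensionLT_one]
    refine injective_of_forall_subsingleton_ext_one _ fun X hX => ?_
    exact subsingleton_ext_X₃ hS (subsingleton_of_forall_eq_zero fun e =>
      e.eq_zero_of_hasInjectiveDimensionLT 1 le_rfl) (h X hX)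
  · exact hasInjectiveDimensionLT_of_ge J 1 2 (by lia)

end InjectiveDimension

section Dual

open scoped ModuleCat

variable (k : Type u) [Field k] {C : Type u} [Ring C] [Algebra k C]

/-- The homomorphism `x ↦ (c ↦ φ (x c))` of right modules induced by a linear form `φ`. -/
def toDual {X : RightMod C} (φ : X →ₗ[k] k) : X ⟶ dualRegular k C :=
  ModuleCat.ofHom
    { toFun := fun x => (show Dual k C from
        { toFun := fun c => φ (MulOpposite.op c • x)
          map_add' := fun a b => by simp [add_smul]
          map_smul' := fun r c => by simp [MulOpposite.op_smul, smul_assoc] } )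
      map_add' := fun x y => LinearMap.ext fun c => by
        change φ _ = φ _ + φ _
        simp
      map_smul' := fun a x => LinearMap.ext fun c => by
        change φ _ = φ (MulOpposite.op (a.unop * c) • x)
        simp [mul_smul] }

theorem toDual_apply {X : RightMod C} (φ : X →ₗ[k] k) (x : X) (c : C) :
    (show C →ₗ[k] k from (toDual k φ).hom x) c = φ (MulOpposite.op c • x) := rfl

/-- The linear form corresponding to a homomorphism of right modules to `DC`. -/
def ofDual {X : RightMod C} (f : X ⟶ dualRegular k C) : X →ₗ[k] k where
  toFun x := (show C →ₗ[k] k from f.hom x) 1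
  map_add' x y := by rw [map_add]; rfl
  map_smul' r x := by
    have : r • x = algebraMap k Cᵐᵒᵖ r • x := (algebraMap_smul Cᵐᵒᵖ r x).symm
    rw [this, map_smul]
    change (show C →ₗ[k] k from f.hom x) (algebraMap k C r * 1) = _
    rw [← Algebra.smul_def, map_smul]
    rfl

theorem toDual_ofDual {X : RightMod C} (f : X ⟶ dualRegular k C) : toDual k (ofDual k f) = f := by
  ext x
  refine LinearMap.ext fun c => ?_
  rw [toDual_apply]
  change (show C →ₗ[k] k from f.hom (MulOpposite.op c • x)) 1 = _
  rw [map_smul]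
  change (show C →ₗ[k] k from f.hom x) (c * 1) = _
  rw [mul_one]

/-- `Hom_C(X, DC)` is the space of linear forms on `X`, and these extend along injections of vector
spaces. -/
instance injective_dualRegular : Injective (dualRegular k C) where
  factors {X Y} g f hf := by
    have hi : Function.Injective f.hom := (ModuleCat.mono_iff_injective f).1 hf
    obtain ⟨l, hl⟩ := (f.hom.restrictScalars k).exists_leftInverse_of_injective
      (LinearMap.ker_eq_bot.2 hi)
    refine ⟨toDual k (ofDual k g ∘ₗ l), ?_⟩
    ext x
    refine LinearMap.ext fun c => ?_
    have := LinearMap.congr_fun hl (MulOpposite.op c • x)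
    simp only [LinearMap.comp_apply, LinearMap.id_apply, LinearMap.restrictScalars_apply,
      map_smul] at this
    change ofDual k g (l (MulOpposite.op c • f.hom x)) = _
    rw [this]
    exact congrArg (fun h : X ⟶ dualRegular k C => (show C →ₗ[k] k from h.hom x) c)
      (toDual_ofDual k g)

variable [FiniteDimensional k C]

instance finite_dualRegular : Module.Finite Cᵐᵒᵖ (dualRegular k C) := by
  let _ : Module k (Dual k C) := inferInstanceAs (Module k (C →ₗ[k] k))
  have : Module.Finite k (Dual k C) := inferInstanceAs (Module.Finite k (C →ₗ[k] k))
  have : IsScalarTower k Cᵐᵒᵖ (Dual k C) := ⟨fun r a f => LinearMap.ext fun x => by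
    change (show C →ₗ[k] k from f) ((r • a.unop) * x) =
      r • (show C →ₗ[k] k from f) (a.unop * x)
    rw [smul_mul_assoc, map_smul]⟩
  exact Module.Finite.of_restrictScalars_finite k Cᵐᵒᵖ (Dual k C)

theorem exists_injective_power_dualRegular (X : RightMod C) [Module.Finite Cᵐᵒᵖ X] :
    ∃ (n : ℕ) (f : X ⟶ power (dualRegular k C) n), Function.Injective f.hom := by
  have := finite_restrictScalars k X
  let b := Module.finBasis k X
  refine ⟨_, ModuleCat.ofHom (LinearMap.pi fun i => (toDual k (b.coord i)).hom), ?_⟩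
  rw [← LinearMap.ker_eq_bot, eq_bot_iff]
  intro x hx
  refine b.ext_elem fun i => ?_
  have : (toDual k (b.coord i)).hom x = 0 := congrFun hx i
  have h1 := toDual_apply k (b.coord i) x 1
  rw [this, MulOpposite.op_one, one_smul] at h1
  rw [map_zero, Finsupp.zero_apply]
  exact h1.symm

theorem hasProjectiveDimensionLT_three (hC : globalDimension C = 2) (X : RightMod C)
    [hX : Module.Finite Cᵐᵒᵖ X] : HasProjectiveDimensionLT X 3 := by
  rw [← HasProjectiveDimensionLE, ← projectiveDimension_le_iff]
  refine le_trans ?_ hC.le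
  exact le_iSup₂_of_le X hX le_rfl

theorem subsingleton_ext_three (hC : globalDimension C = 2) (X Y : RightMod C)
    [Module.Finite Cᵐᵒᵖ X] : Subsingleton (Ext X Y 3) := by
  have := hasProjectiveDimensionLT_three hC X
  exact HasProjectiveDimensionLT.subsingleton X 3 3 le_rfl Y

/-- A finitely generated `X` embeds in some `DCⁿ` with finitely generated cokernel `Z`. Then
`Ext²(X, M)` lies between `Ext²(DCⁿ, M)` and `Ext³(Z, M) = 0`. -/
theorem injectiveDimension_le_one_iff (hC : globalDimension C = 2) (M : RightMod C) :
    injectiveDimension M ≤ 1 ↔ Subsingleton (Ext (dualRegular k C) M 2) := by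
  refine (injectiveDimension_le_iff M 1).trans ⟨fun h => ?_, fun h => ?_⟩
  · exact subsingleton_of_forall_eq_zero fun e => e.eq_zero_of_hasInjectiveDimensionLT 2 le_rfl
  · refine hasInjectiveDimensionLT_two_of_forall_subsingleton_ext_two M fun X hX => ?_
    obtain ⟨n, f, hf⟩ := exists_injective_power_dualRegular k X
    have hS : (ShortComplex.mk f (ModuleCat.ofHom (LinearMap.range f.hom).mkQ)
        (by ext x; simp)).ShortExact :=
      ModuleCat.shortComplex_shortExact _ (LinearMap.exact_map_mkQ_range f.hom) hf
        (Submodule.mkQ_surjective _)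
    refine subsingleton_ext_of_X₁ hS (subsingleton_ext_power_left n h) ?_
    have : Module.Finite Cᵐᵒᵖ (ModuleCat.of Cᵐᵒᵖ
      (power (dualRegular k C) n ⧸ LinearMap.range f.hom)) :=
      inferInstanceAs (Module.Finite Cᵐᵒᵖ ((Fin n → dualRegular k C) ⧸ LinearMap.range f.hom))
    exact subsingleton_ext_three hC _ M

end Dual

/-! ### Modules generated by `M` -/

section Generates

variable {A : Type u} [Ring A]

/-- `X` is a quotient of a finite power of `M`. -/
def Generates (M X : ModuleCat.{u} A) : Prop :=
  ∃ (n : ℕ) (q : power M n ⟶ X), Function.Surjective q.hom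

theorem subsingleton_ext_one_of_generates {M X : ModuleCat.{u} A}
    (h₂ : ∀ Y : ModuleCat.{u} A, Subsingleton (Ext M Y 2)) (h₁ : Subsingleton (Ext M M 1))
    (h : Generates M X) : Subsingleton (Ext M X 1) := by
  obtain ⟨n, q, hq⟩ := h
  exact subsingleton_ext_X₃ (kerComplex_shortExact q hq) (subsingleton_ext_power_right n h₁)
    (h₂ _)

end Generates

/-! ### `Ext²(DC, M)` as the tensor product `M ⊗_C E` -/

section Balanced

variable (k : Type u) [Field k] {C : Type u} [Ring C] [Algebra k C]

/-- The homomorphism `C ⟶ M`, `c ↦ m c`. -/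
def orbitMap {M : RightMod C} (m : M) : regular C ⟶ M :=
  ModuleCat.ofHom
    { toFun := fun c => MulOpposite.op c • m
      map_add' := fun a b => by simp [add_smul]
      map_smul' := fun a c => by
        change MulOpposite.op (c * a.unop) • m = a • MulOpposite.op c • m
        rw [← mul_smul]; rfl }

theorem orbitMap_apply {M : RightMod C} (m : M) (c : C) :
    (orbitMap m).hom c = MulOpposite.op c • m := rfl

theorem orbitMap_add {M : RightMod C} (m m' : M) :
    orbitMap (m + m') = orbitMap m + orbitMap m' := by
  refine ModuleCat.hom_ext (LinearMap.ext fun c => ?_)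
  exact smul_add (MulOpposite.op c) m m'

theorem leftMul_comp_orbitMap {M : RightMod C} (m : M) (c : C) :
    leftMul C c ≫ orbitMap m = orbitMap (MulOpposite.op c • m) := by
  refine ModuleCat.hom_ext (LinearMap.ext fun x => ?_)
  change MulOpposite.op (c * x) • m = MulOpposite.op x • MulOpposite.op c • m
  rw [← mul_smul]; rfl

theorem orbitMap_comp {M N : RightMod C} (m : M) (f : M ⟶ N) :
    orbitMap m ≫ f = orbitMap (f.hom m) := by
  refine ModuleCat.hom_ext (LinearMap.ext fun x => ?_)
  exact map_smul f.hom (MulOpposite.op x) m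

theorem orbitMap_regular (c : C) : orbitMap (M := regular C) c = leftMul C c := by
  refine ModuleCat.hom_ext (LinearMap.ext fun x => ?_)
  rfl

/-- The canonical map `M ⊗_C Ext²(DC, C) ⟶ Ext²(DC, M)`, as a biadditive map. -/
def extPairing (M : RightMod C) :
    M →+ ExtBimodule k C →+ Ext (dualRegular k C) M 2 :=
  AddMonoidHom.mk'
    (fun m => AddMonoidHom.mk' (fun e : ExtBimodule k C =>
      Ext.comp (show Ext (dualRegular k C) (regular C) 2 from e) (Ext.mk₀ (orbitMap m))
        (add_zero 2)) (fun _ _ => Ext.add_comp _ _ _ _))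
    (fun m m' => by
      ext e
      change Ext.comp _ _ (add_zero 2) = Ext.comp _ _ (add_zero 2) + Ext.comp _ _ (add_zero 2)
      rw [orbitMap_add, Ext.mk₀_add, Ext.comp_add])

theorem extPairing_apply (M : RightMod C) (m : M) (e : Ext (dualRegular k C) (regular C) 2) :
    extPairing k M m e = e.comp (Ext.mk₀ (orbitMap m)) (add_zero 2) := rfl

theorem extPairing_smul (M : RightMod C) (m : M) (c : C) (e : ExtBimodule k C) :
    extPairing k M (MulOpposite.op c • m) e = extPairing k M m (c • e) := by
  have h : ∀ e' : Ext (dualRegular k C) (regular C) 2,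
      e'.comp (Ext.mk₀ (orbitMap (MulOpposite.op c • m))) (add_zero 2) =
        (e'.comp (Ext.mk₀ (leftMul C c)) (add_zero 2)).comp (Ext.mk₀ (orbitMap m))
          (add_zero 2) := fun e' => by
    rw [Ext.comp_assoc_of_third_deg_zero, Ext.mk₀_comp_mk₀, leftMul_comp_orbitMap]
  exact h e

theorem extPairing_comp {M N : RightMod C} (f : M ⟶ N) (m : M) (e : ExtBimodule k C) :
    (extPairing k M m e).comp (Ext.mk₀ f) (add_zero 2) = extPairing k N (f.hom m) e := by
  change (Ext.comp _ _ (add_zero 2)).comp _ (add_zero 2) = Ext.comp _ _ (add_zero 2)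
  rw [Ext.comp_assoc_of_third_deg_zero, Ext.mk₀_comp_mk₀, orbitMap_comp]

instance finite_regular : Module.Finite Cᵐᵒᵖ (regular C) :=
  ⟨⟨{(1 : C)}, by
    rw [eq_top_iff]
    intro x _
    refine Submodule.mem_span.2 fun p hp => ?_
    have : x = MulOpposite.op (x : C) • (1 : C) := (one_mul (x : C)).symm
    rw [this]
    exact p.smul_mem _ (hp (by simp))⟩⟩

/-- The homomorphism `C^n ⟶ M` given by a family of elements. -/
def familyMap {M : RightMod C} {n : ℕ} (m : Fin n → M) : power (regular C) n ⟶ M :=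
  ∑ i, powerProj (regular C) n i ≫ orbitMap (m i)

theorem familyMap_apply {M : RightMod C} {n : ℕ} (m : Fin n → M) (x : Fin n → C) :
    (familyMap m).hom x = ∑ i, MulOpposite.op (x i) • m i := by
  simp only [familyMap, ModuleCat.hom_sum, LinearMap.sum_apply]
  rfl

theorem exists_familyMap_surjective (M : RightMod C) [Module.Finite Cᵐᵒᵖ M] :
    ∃ (n : ℕ) (m : Fin n → M), Function.Surjective (familyMap m).hom := by
  obtain ⟨n, m, hm⟩ := Module.Finite.exists_fin (R := Cᵐᵒᵖ) (M := M)
  refine ⟨n, m, fun x => ?_⟩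
  obtain ⟨c, rfl⟩ := (Submodule.mem_span_range_iff_exists_fun Cᵐᵒᵖ).1
    (hm ▸ Submodule.mem_top : x ∈ Submodule.span Cᵐᵒᵖ (Set.range m))
  exact ⟨fun i => (c i).unop, by rw [familyMap_apply]; rfl⟩

variable {k}
variable [FiniteDimensional k C]

/-- Since `Ext³(DC, -) = 0`, the class `w` lifts along `Cⁿ ⟶ M` to `Ext²(DC, Cⁿ) = Eⁿ`. -/
theorem exists_extPairing_sum (hC : globalDimension C = 2) (M : RightMod C) {n : ℕ}
    (m : Fin n → M) (hm : Function.Surjective (familyMap m).hom)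
    (w : Ext (dualRegular k C) M 2) :
    ∃ e : Fin n → ExtBimodule k C, w = ∑ i, extPairing k M (m i) (e i) := by
  obtain ⟨v, rfl⟩ := exists_ext_lift (kerComplex_shortExact _ hm)
    (subsingleton_ext_three hC (dualRegular k C) _) w
  refine ⟨fun i => v.comp (Ext.mk₀ (powerProj _ n i)) (add_zero 2), ?_⟩
  change v.comp (Ext.mk₀ (familyMap m)) _ = _
  rw [familyMap, Ext.mk₀_sum, Ext.comp_sum]
  refine Finset.sum_congr rfl fun i _ => ?_
  rw [extPairing_apply, ← Ext.mk₀_comp_mk₀, Ext.comp_assoc_of_third_deg_zero]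

/-- This is injectivity of `M ⊗_C E → Ext²(DC, M)`, phrased through the universal property. With `K`
the kernel of `Cⁿ ⟶ M`, an element `e` placed at coordinate `i` of `Eⁿ` dies in `Ext²(DC, M) = 0`,
so it comes from `Ext²(DC, K)`, which is spanned by products `κ ε`. Balancedness moves the
coordinates of each `κ` onto the generators `m j`, where they sum to zero. -/
theorem balanced_eq_zero (hC : globalDimension C = 2) (M : RightMod C) [Module.Finite Cᵐᵒᵖ M]
    (hM : Subsingleton (Ext (dualRegular k C) M 2)) {X : Type*} [AddCommGroup X]
    (β : M →+ ExtBimodule k C →+ X)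
    (hβ : ∀ (m : M) (c : C) (e : ExtBimodule k C), β (MulOpposite.op c • m) e = β m (c • e)) :
    β = 0 := by
  have : IsNoetherianRing Cᵐᵒᵖ := IsNoetherianRing.of_finite k Cᵐᵒᵖ
  obtain ⟨n, m, hm⟩ := exists_familyMap_surjective M
  have hS := kerComplex_shortExact _ hm
  let K := (kerComplex (familyMap m)).X₁
  have : Module.Finite Cᵐᵒᵖ (Fin n → regular C) := inferInstance
  have : Module.Finite Cᵐᵒᵖ K :=
    inferInstanceAs (Module.Finite Cᵐᵒᵖ (LinearMap.ker (familyMap m).hom))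
  obtain ⟨l, κ, hκ⟩ := exists_familyMap_surjective K
  have key : ∀ i e, β (m i) e = 0 := by
    intro i e
    obtain ⟨e₀, he₀⟩ : ∃ e₀ : Ext (dualRegular k C) (regular C) 2, e₀ = e := ⟨e, rfl⟩
    obtain ⟨ξ, hξ⟩ := Ext.covariant_sequence_exact₂ (dualRegular k C) hS
      (e₀.comp (Ext.mk₀ (powerIncl (regular C) n i)) (add_zero 2)) (Subsingleton.elim _ _)
    obtain ⟨ε, rfl⟩ := exists_extPairing_sum hC K κ hκ ξ
    -- The relation `∑ κ ε = (0, …, e, …, 0)` in `Eⁿ`, read off coordinate by coordinate.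
    have hrel : ∀ j, ∑ s, ((κ s).1 j : C) • ε s = (Pi.single i e : Fin n → ExtBimodule k C) j := by
      intro j
      have h1 := congrArg (fun z => Ext.comp z (Ext.mk₀ (powerProj (regular C) n j))
        (add_zero 2)) hξ
      simp only [Ext.sum_comp] at h1
      have h2 : powerIncl (regular C) n i ≫ powerProj (regular C) n j =
          if i = j then 𝟙 _ else 0 := by
        split_ifs with hij
        · subst hij
          refine ModuleCat.hom_ext (LinearMap.ext fun x => ?_)
          exact Pi.single_eq_same (M := fun _ => C) i x
        · refine ModuleCat.hom_ext (LinearMap.ext fun x => ?_)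
          exact Pi.single_eq_of_ne (M := fun _ => C) (Ne.symm hij) x
      rw [Ext.comp_assoc_of_third_deg_zero, Ext.mk₀_comp_mk₀, h2] at h1
      have h3 : ∀ s : Fin l, ((extPairing k K (κ s) (ε s)).comp (Ext.mk₀ (kerComplex (familyMap m)).f)
          (add_zero 2)).comp (Ext.mk₀ (powerProj (regular C) n j)) (add_zero 2) =
          ((κ s).1 j : C) • ε s := by
        intro s
        rw [extPairing_comp, extPairing_comp]
        change Ext.comp _ _ (add_zero 2) = Ext.comp _ (Ext.mk₀ (leftMul C ((κ s).1 j))) (add_zero 2)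
        rw [← orbitMap_regular]
        rfl
      rw [Finset.sum_congr rfl fun s _ => h3 s] at h1
      refine h1.trans ?_
      split_ifs with hij
      · subst hij
        rw [Pi.single_eq_same]
        exact (Ext.comp_mk₀_id e₀).trans he₀
      · rw [Pi.single_eq_of_ne (Ne.symm hij), Ext.mk₀_zero]
        exact Ext.comp_zero e₀ _ _ _ _
    have h4 : β (m i) e = ∑ j, β (m j) ((Pi.single i e : Fin n → ExtBimodule k C) j) := by
      rw [Finset.sum_eq_single i, Pi.single_eq_same]
      · intro j _ hj
        rw [Pi.single_eq_of_ne hj, map_zero]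
      · simp
    rw [h4]
    simp_rw [← hrel, map_sum, ← hβ]
    rw [Finset.sum_comm]
    refine Finset.sum_eq_zero fun s _ => ?_
    have h5 : ∑ j, MulOpposite.op ((κ s).1 j : C) • m j = 0 := by
      rw [← familyMap_apply]
      exact (κ s).2
    calc ∑ j, β (MulOpposite.op ((κ s).1 j : C) • m j) (ε s)
        = (β (∑ j, MulOpposite.op ((κ s).1 j : C) • m j)) (ε s) := by
          rw [map_sum, AddMonoidHom.finsetSum_apply]
      _ = 0 := by rw [h5, map_zero]; rfl
  ext x e
  obtain ⟨c, rfl⟩ := hm x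
  rw [familyMap_apply, map_sum, AddMonoidHom.finsetSum_apply]
  exact Finset.sum_eq_zero fun i _ => by rw [hβ, key]

end Balanced

/-! ### From `τ`-rigidity over `B` to vanishing of `Ext²(DC, M)` -/

section Inflation

open scoped ModuleCat

variable {k : Type u} [Field k] {C : Type u} [Ring C] [Algebra k C]

theorem inflation_smul (M : RightMod C) (b : RelationExtension k C)
    (m : (inflation k C).obj M) :
    MulOpposite.op b • m = (show (inflation k C).obj M from
      MulOpposite.op b.fst • (show M from m)) := rfl

theorem inflation_inr_smul (M : RightMod C) (e : ExtBimodule k C)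
    (m : (inflation k C).obj M) :
    MulOpposite.op (TrivSqZeroExt.inr e : RelationExtension k C) • m = 0 := by
  rw [inflation_smul, TrivSqZeroExt.fst_inr, MulOpposite.op_zero]
  exact zero_smul Cᵐᵒᵖ (show M from m)

/-- The product `M × X` as a module over the relation extension, where `e` acts by
`(m, x) e = (0, β m e)`. -/
def TwistedProd {M X : RightMod C} (_ : M →+ ExtBimodule k C →+ X) : Type u := M × X

variable {M X : RightMod C} (β : M →+ ExtBimodule k C →+ X)

instance : AddCommGroup (TwistedProd β) := inferInstanceAs (AddCommGroup (M × X))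

/-- The module structure on `TwistedProd β`. -/
abbrev twistedModule
    (h₁ : ∀ (m : M) (c : C) (e : ExtBimodule k C), β (MulOpposite.op c • m) e = β m (c • e))
    (h₂ : ∀ (m : M) (c : C) (e : ExtBimodule k C),
      β m (MulOpposite.op c • e) = MulOpposite.op c • β m e) :
    Module (RelationExtension k C)ᵐᵒᵖ (TwistedProd β) where
  smul b v := (show M × X from (MulOpposite.op b.unop.fst • (show M × X from v).1,
    MulOpposite.op b.unop.fst • (show M × X from v).2 + β (show M × X from v).1 b.unop.snd))
  one_smul v := Prod.ext (one_smul Cᵐᵒᵖ _) (by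
    change MulOpposite.op (1 : C) • (show M × X from v).2 + β _ 0 = _
    rw [map_zero, add_zero]
    exact one_smul Cᵐᵒᵖ _)
  mul_smul a b v := Prod.ext (mul_smul (MulOpposite.op a.unop.fst) (MulOpposite.op b.unop.fst) _)
    (by
      change MulOpposite.op (b.unop.fst * a.unop.fst) • (show M × X from v).2 +
          β (show M × X from v).1
            (b.unop.fst • a.unop.snd + MulOpposite.op a.unop.fst • b.unop.snd) =
        MulOpposite.op a.unop.fst • (MulOpposite.op b.unop.fst • (show M × X from v).2 +
          β (show M × X from v).1 b.unop.snd) +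
          β (MulOpposite.op b.unop.fst • (show M × X from v).1) a.unop.snd
      rw [MulOpposite.op_mul, mul_smul, map_add, h₁, h₂, smul_add]
      abel)
  smul_zero a := Prod.ext (smul_zero (MulOpposite.op a.unop.fst)) (by
    change MulOpposite.op a.unop.fst • (0 : X) + β 0 a.unop.snd = 0
    rw [map_zero, smul_zero, AddMonoidHom.zero_apply, add_zero])
  smul_add a v w := Prod.ext (smul_add (MulOpposite.op a.unop.fst) _ _) (by
    change MulOpposite.op a.unop.fst • ((show M × X from v).2 + (show M × X from w).2) +
        β ((show M × X from v).1 + (show M × X from w).1) a.unop.snd =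
      (MulOpposite.op a.unop.fst • (show M × X from v).2 + β (show M × X from v).1 a.unop.snd) +
      (MulOpposite.op a.unop.fst • (show M × X from w).2 + β (show M × X from w).1 a.unop.snd)
    rw [map_add, smul_add, AddMonoidHom.add_apply]
    abel)
  add_smul a b v := Prod.ext (add_smul (MulOpposite.op a.unop.fst) (MulOpposite.op b.unop.fst) _)
    (by
      change MulOpposite.op (a.unop.fst + b.unop.fst) • (show M × X from v).2 +
          β (show M × X from v).1 (a.unop.snd + b.unop.snd) =
        (MulOpposite.op a.unop.fst • (show M × X from v).2 + β (show M × X from v).1 a.unop.snd) +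
        (MulOpposite.op b.unop.fst • (show M × X from v).2 + β (show M × X from v).1 b.unop.snd)
      rw [map_add, MulOpposite.op_add, add_smul]
      abel)
  zero_smul v := Prod.ext (zero_smul Cᵐᵒᵖ _) (by
    change MulOpposite.op (0 : C) • (show M × X from v).2 + β (show M × X from v).1 0 = 0
    rw [map_zero, MulOpposite.op_zero, zero_smul, add_zero])

/-- A balanced map vanishes if every homomorphism from the first term of a projective
presentation of the inflation of `M` to that of `X` extends. -/
theorem balanced_eq_zero_of_extension
    (h₁ : ∀ (m : M) (c : C) (e : ExtBimodule k C), β (MulOpposite.op c • m) e = β m (c • e))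
    (h₂ : ∀ (m : M) (c : C) (e : ExtBimodule k C),
      β m (MulOpposite.op c • e) = MulOpposite.op c • β m e)
    (p : MinimalPresentation ((inflation k C).obj M))
    (hp : ∀ g : p.P₁ ⟶ (inflation k C).obj X, ∃ h : p.P₀ ⟶ (inflation k C).obj X,
      p.d₁ ≫ h = g) : β = 0 := by
  have := p.projective₀
  let _ := twistedModule β h₁ h₂
  let π : TwistedProd β →ₗ[(RelationExtension k C)ᵐᵒᵖ] (inflation k C).obj M :=
    { toFun := fun v => (show M × X from v).1
      map_add' := fun _ _ => rfl
      map_smul' := fun _ _ => rfl }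
  have hπ : Function.Surjective π := fun m => ⟨(show M × X from (m, 0)), rfl⟩
  -- The projective `P₀` maps to the twisted extension of `M` by `X`, lifting `d₀`.
  obtain ⟨ψ, hψ⟩ := Module.projective_lifting_property π p.d₀.hom hπ
  have hψ₁ : ∀ x, (show M × X from ψ x).1 = p.d₀.hom x := fun x => LinearMap.congr_fun hψ x
  have hd : ∀ x, p.d₀.hom (p.d₁.hom x) = 0 := fun x => (p.exact _).2 ⟨x, rfl⟩
  have h0 : ∀ z : M, z = 0 → ∀ e, β z e = 0 := by
    rintro _ rfl e
    rw [map_zero]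
    rfl
  -- The second coordinate is not `B`-linear in general; it becomes so after `d₁`, where the first
  -- coordinate is zero and `β` no longer contributes.
  let g : p.P₁ →ₗ[(RelationExtension k C)ᵐᵒᵖ] (inflation k C).obj X :=
    { toFun := fun x => (show M × X from ψ (p.d₁.hom x)).2
      map_add' := fun x y => by
        rw [map_add, map_add]
        rfl
      map_smul' := fun b x => by
        rw [map_smul, map_smul]
        change MulOpposite.op b.unop.fst • (show M × X from ψ (p.d₁.hom x)).2 +
          β (show M × X from ψ (p.d₁.hom x)).1 b.unop.snd = _
        rw [h0 _ ((hψ₁ _).trans (hd x))]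
        exact add_zero _ }
  obtain ⟨h, hh⟩ := hp (ModuleCat.ofHom (Y := (inflation k C).obj X) g)
  ext m e
  obtain ⟨x, rfl⟩ := p.surjective m
  -- The element `x e` lies in the image of `d₁`. There the second coordinate of `ψ` is `β (d₀ x)
  -- e`, while the extension `h` takes the value `h(x) e = 0`.
  obtain ⟨y, hy⟩ := (p.exact (MulOpposite.op (TrivSqZeroExt.inr e) • x)).1 (by
    rw [map_smul]; exact inflation_inr_smul M e _)
  have h3 : (show M × X from ψ (MulOpposite.op (TrivSqZeroExt.inr e : RelationExtension k C) • x)).2 =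
      β (p.d₀.hom x) e := by
    rw [map_smul, ← hψ₁]
    change MulOpposite.op (0 : C) • (show M × X from ψ x).2 + _ = _
    rw [MulOpposite.op_zero, zero_smul, zero_add]
    rfl
  have h4 := congrArg (fun f : p.P₁ ⟶ (inflation k C).obj X => f.hom y) hh
  change h.hom (p.d₁.hom y) = (show M × X from ψ (p.d₁.hom y)).2 at h4
  rw [hy, h3, map_smul] at h4
  rw [← h4]
  exact inflation_inr_smul X e _

/-- As `P₁` is projective, `g` lifts to `Mⁿ`, where it extends one coordinate at a time. -/
theorem exists_extension_of_generates {Λ : Type u} [Ring Λ] {M X : RightMod Λ}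
    (p : MinimalPresentation M) (hp : ∀ g : p.P₁ ⟶ M, ∃ h : p.P₀ ⟶ M, p.d₁ ≫ h = g)
    {n : ℕ} (q : (Fin n → M) →ₗ[Λᵐᵒᵖ] X) (hq : Function.Surjective q) (g : p.P₁ ⟶ X) :
    ∃ h : p.P₀ ⟶ X, p.d₁ ≫ h = g := by
  have := p.projective₁
  obtain ⟨f, hf⟩ := Module.projective_lifting_property q g.hom hq
  choose h hh using fun i => hp (ModuleCat.ofHom (LinearMap.proj i ∘ₗ f))
  refine ⟨ModuleCat.ofHom (q ∘ₗ LinearMap.pi fun i => (h i).hom), ?_⟩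
  ext x
  have h1 : (fun i => (h i).hom (p.d₁.hom x)) = f x := funext fun i =>
    congrArg (fun f : p.P₁ ⟶ M => f.hom x) (hh i)
  exact (congrArg q h1).trans (LinearMap.congr_fun hf x)

variable [FiniteDimensional k C]

/-- A linear form `φ` with `φ w ≠ 0` corresponds by adjunction to the balanced map `β m e = (c ↦ φ
(m ⊗ e c))` into `DC`. Since `M` generates `DC`, rigidity forces `β = 0`; evaluating at `c = 1`
shows that `φ` kills all `m ⊗ e`, and `w` is a sum of these. -/
theorem subsingleton_ext_two_of_isTauRigid (hC : globalDimension C = 2) (M : RightMod C)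
    [Module.Finite Cᵐᵒᵖ M] (hgen : Generates M (dualRegular k C))
    (h : IsTauRigid k ((inflation k C).obj M)) : Subsingleton (Ext (dualRegular k C) M 2) := by
  obtain ⟨p, hp⟩ := h
  have hp := forall_exists_extension_of_subsingleton_hom_tau k p hp
  refine subsingleton_of_forall_eq_zero fun w => ?_
  by_contra hw
  obtain ⟨φ, hφw, -⟩ := Submodule.exists_le_ker_of_notMem (p := (⊥ : Submodule k _))
    (v := w) (by simpa using hw)
  have hsm : ∀ (m : M) (c : C) (e : ExtBimodule k C),
      extPairing k M m (MulOpposite.op c • e) =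
        (Ext.mk₀ (leftMulDual k C c)).comp (extPairing k M m e) (zero_add 2) := by
    have : ∀ (m : M) (c : C) (e : Ext (dualRegular k C) (regular C) 2),
        ((Ext.mk₀ (leftMulDual k C c)).comp e (zero_add 2)).comp (Ext.mk₀ (orbitMap m))
          (add_zero 2) =
        (Ext.mk₀ (leftMulDual k C c)).comp (e.comp (Ext.mk₀ (orbitMap m)) (add_zero 2))
          (zero_add 2) := fun m c e => by rw [Ext.comp_assoc_of_third_deg_zero]
    exact this
  have hsmul : ∀ (r : k) (c : C),
      Ext.mk₀ (leftMulDual k C (r • c)) = r • Ext.mk₀ (leftMulDual k C c) := by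
    intro r c
    refine Eq.trans ?_ (Ext.mk₀_smul r _)
    congr 1
    refine ModuleCat.hom_ext (LinearMap.ext fun f => LinearMap.ext fun x => ?_)
    change (show C →ₗ[k] k from f) (x * (r • c)) =
      (show C →ₗ[k] k from f) ((algebraMap k C r * x) * c)
    rw [← Algebra.smul_def, mul_smul_comm, smul_mul_assoc]
  let β : M →+ ExtBimodule k C →+ dualRegular k C :=
    AddMonoidHom.mk' (fun m => AddMonoidHom.mk' (fun e =>
      (show Dual k C from
        { toFun := fun c => φ (extPairing k M m (MulOpposite.op c • e))
          map_add' := fun a b => by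
            rw [MulOpposite.op_add, add_smul, map_add, map_add]
          map_smul' := fun r c => by
            rw [hsm, hsm, hsmul, Ext.smul_comp, map_smul]
            rfl }))
      (fun e e' => LinearMap.ext fun c => by
        change φ _ = φ _ + φ _
        rw [smul_add, map_add, map_add]))
      (fun m m' => AddMonoidHom.ext fun e => LinearMap.ext fun c => by
        change φ _ = φ _ + φ _
        rw [map_add, AddMonoidHom.add_apply, map_add])
  have hβ : ∀ (m : M) (e : ExtBimodule k C) (c : C), (show C →ₗ[k] k from β m e) c =
      φ (extPairing k M m (MulOpposite.op c • e)) := fun _ _ _ => rfl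
  have hβ0 : β = 0 := by
    refine balanced_eq_zero_of_extension β (fun m c e => LinearMap.ext fun x => ?_)
      (fun m c e => LinearMap.ext fun x => ?_) p fun g => ?_
    · rw [hβ, hβ, extPairing_smul, smul_comm]
    · change φ _ = φ (extPairing k M m (MulOpposite.op (c * x) • e))
      rw [MulOpposite.op_mul, mul_smul]
    · obtain ⟨n, q, hq⟩ := hgen
      let q' : (Fin n → (inflation k C).obj M) →ₗ[(RelationExtension k C)ᵐᵒᵖ]
          (inflation k C).obj (dualRegular k C) :=
        { toFun := fun v => q.hom (show Fin n → M from v)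
          map_add' := fun a b => map_add q.hom _ _
          map_smul' := fun b v => map_smul q.hom (MulOpposite.op b.unop.fst) _ }
      exact exists_extension_of_generates p hp q' hq g
  apply hφw
  obtain ⟨n, m, hm⟩ := exists_familyMap_surjective M
  obtain ⟨e, rfl⟩ := exists_extPairing_sum hC M m hm w
  rw [map_sum]
  refine Finset.sum_eq_zero fun i _ => ?_
  have h1 := hβ (m i) (e i) 1
  rw [hβ0, MulOpposite.op_one, one_smul] at h1
  exact h1.symm

end Inflation

/-! ### Finite-dimensionality of `B` -/

section RelationExtensionFinite

variable (k : Type u) [Field k] (C : Type u) [Ring C] [Algebra k C]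

/-- The action of `k` on `E` was defined through `C`; its agreement with the linear structure of
`Ext` lets finite-dimensionality carry over. -/
theorem extBimodule_smul_eq (r : k) (e : ExtBimodule k C) :
    r • e = (show ExtBimodule k C from
      r • (show Ext (dualRegular k C) (regular C) 2 from e)) := by
  have h : ∀ e' : Ext (dualRegular k C) (regular C) 2,
      e'.comp (Ext.mk₀ (leftMul C (algebraMap k C r))) (add_zero 2) = r • e' := by
    intro e'
    rw [Ext.smul_eq_comp_mk₀]
    congr 2
    refine ModuleCat.hom_ext (LinearMap.ext fun x => ?_)
    exact Algebra.commutes (A := C) r x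
  exact h e

variable [FiniteDimensional k C]

instance finite_extBimodule : Module.Finite k (ExtBimodule k C) := by
  have := finite_ext k (dualRegular k C) (regular C) 2
  let f : Ext (dualRegular k C) (regular C) 2 →ₗ[k] ExtBimodule k C :=
    { toFun := fun e => e
      map_add' := fun _ _ => rfl
      map_smul' := fun r e => (extBimodule_smul_eq k C r e).symm }
  exact Module.Finite.of_surjective f fun e => ⟨e, rfl⟩

instance finite_relationExtension : Module.Finite k (RelationExtension k C) :=
  inferInstanceAs (Module.Finite k (C × ExtBimodule k C))

instance : IsArtinianRing (RelationExtension k C)ᵐᵒᵖ :=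
  IsArtinianRing.of_finite k _

instance : IsNoetherianRing (RelationExtension k C)ᵐᵒᵖ :=
  IsNoetherianRing.of_finite k _

end RelationExtensionFinite

/-! ### From vanishing of `Ext²(DC, M)` to `τ`-rigidity over `B` -/

section TauRigidInflation

variable {k : Type u} [Field k] {C : Type u} [Ring C] [Algebra k C]

/-- Restriction of right modules along the inclusion `C ⟶ B` of `C` into its relation
extension. -/
abbrev restriction (k : Type u) [Field k] (C : Type u) [Ring C] [Algebra k C] :
    RightMod (RelationExtension k C) ⥤ RightMod C :=
  ModuleCat.restrictScalars
    (RingHom.op (TrivSqZeroExt.inlHom C (ExtBimodule k C)))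

theorem op_smul_eq_add {X : Type*} [AddCommGroup X] [Module (RelationExtension k C)ᵐᵒᵖ X]
    (b : RelationExtension k C) (x : X) :
    MulOpposite.op b • x =
      MulOpposite.op (TrivSqZeroExt.inl b.fst : RelationExtension k C) • x +
        MulOpposite.op (TrivSqZeroExt.inr b.snd : RelationExtension k C) • x := by
  rw [← add_smul, ← MulOpposite.op_add, TrivSqZeroExt.inl_fst_add_inr_snd_eq]

theorem finite_inflation (M : RightMod C) [Module.Finite Cᵐᵒᵖ M] :
    Module.Finite (RelationExtension k C)ᵐᵒᵖ ((inflation k C).obj M) := by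
  classical
  obtain ⟨n, m, hm⟩ := Module.Finite.exists_fin (R := Cᵐᵒᵖ) (M := M)
  let m' : Fin n → (inflation k C).obj M := m
  refine ⟨⟨Finset.univ.image m', ?_⟩⟩
  rw [eq_top_iff]
  intro x _
  obtain ⟨c, hc⟩ := (Submodule.mem_span_range_iff_exists_fun Cᵐᵒᵖ).1
    (hm ▸ Submodule.mem_top : (show M from x) ∈ Submodule.span Cᵐᵒᵖ (Set.range m))
  have : x = ∑ i, MulOpposite.op (TrivSqZeroExt.inl (c i).unop : RelationExtension k C) •
      m' i := hc.symm
  rw [this]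
  exact Submodule.sum_mem _ fun i _ => Submodule.smul_mem _ _ (Submodule.subset_span
    (Finset.mem_coe.2 (Finset.mem_image_of_mem m' (Finset.mem_univ i))))

variable [FiniteDimensional k C]

/-- The only obstruction to extending `u : ker d₀ → X` that is not already seen by `Ext¹_C(M, X)` is
its restriction to `P₀ E`. This restriction is a balanced map on `M × E`, hence zero. -/
theorem isTauRigid_inflation (hC : globalDimension C = 2) (M : RightMod C)
    [Module.Finite Cᵐᵒᵖ M] (hM : Subsingleton (Ext (dualRegular k C) M 2))
    (hext : ∀ X : RightMod C, ∀ q : M ⟶ X, Function.Surjective q.hom →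
      Subsingleton (Ext M X 1)) : IsTauRigid k ((inflation k C).obj M) := by
  have := finite_inflation (k := k) M
  obtain ⟨p⟩ := nonempty_minimalPresentation ((inflation k C).obj M)
  refine ⟨p, subsingleton_hom_tau_of_forall_exists_extension k p fun g =>
    p.forall_exists_extension (fun X q hq u => ?_) g⟩
  have hX : ∀ (x : X) (e : ExtBimodule k C),
      MulOpposite.op (TrivSqZeroExt.inr e : RelationExtension k C) • x = 0 := fun x e => by
    obtain ⟨m, rfl⟩ := hq x
    rw [← map_smul, inflation_inr_smul, map_zero]
  have hker : ∀ (x : p.P₀) (e : ExtBimodule k C),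
      MulOpposite.op (TrivSqZeroExt.inr e : RelationExtension k C) • x ∈
        LinearMap.ker p.d₀.hom := fun x e => by
    rw [LinearMap.mem_ker, map_smul, inflation_inr_smul]
  -- the pairing measuring the failure of `u` to vanish on `P₀ E`
  let a : p.P₀ →+ ExtBimodule k C →+ X :=
    AddMonoidHom.mk' (fun x => AddMonoidHom.mk'
      (fun e => u ⟨MulOpposite.op (TrivSqZeroExt.inr e : RelationExtension k C) • x, hker x e⟩)
      (fun e e' => by
        rw [← map_add]
        congr 1
        exact Subtype.ext (by simp [add_smul])))
      (fun x y => AddMonoidHom.ext fun e => by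
        change u _ = u _ + u _
        rw [← map_add]
        congr 1
        exact Subtype.ext (by simp))
  have ha : ∀ x e, a x e =
      u ⟨MulOpposite.op (TrivSqZeroExt.inr e : RelationExtension k C) • x, hker x e⟩ :=
    fun _ _ => rfl
  have ha0 : ∀ x, p.d₀.hom x = 0 → a x = 0 := fun x hx => AddMonoidHom.ext fun e => by
    have : (⟨MulOpposite.op (TrivSqZeroExt.inr e : RelationExtension k C) • x, hker x e⟩ :
        LinearMap.ker p.d₀.hom) =
        MulOpposite.op (TrivSqZeroExt.inr e : RelationExtension k C) • ⟨x, hx⟩ := rfl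
    rw [ha, this, map_smul, hX]
    rfl
  -- For `x ∈ ker d₀` one has `u(x e) = u(x) e = 0`, so the pairing descends along `d₀` to `M`.
  let β : M →+ ExtBimodule k C →+ X :=
    (QuotientAddGroup.lift p.d₀.hom.toAddMonoidHom.ker a ha0).comp
      (QuotientAddGroup.quotientKerEquivOfSurjective p.d₀.hom.toAddMonoidHom
        p.surjective).symm.toAddMonoidHom
  have hβ : ∀ x, β (p.d₀.hom x) = a x := fun x => by
    have : (QuotientAddGroup.quotientKerEquivOfSurjective p.d₀.hom.toAddMonoidHom
        p.surjective).symm (p.d₀.hom x) = QuotientAddGroup.mk x := by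
      rw [AddEquiv.symm_apply_eq]; rfl
    exact congrArg (QuotientAddGroup.lift p.d₀.hom.toAddMonoidHom.ker a ha0) this
  have hβ0 : β = 0 := by
    refine balanced_eq_zero hC M hM β fun m c e => ?_
    obtain ⟨x, rfl⟩ := p.surjective m
    have h1 : MulOpposite.op c • (show M from p.d₀.hom x) =
        p.d₀.hom (MulOpposite.op (TrivSqZeroExt.inl c : RelationExtension k C) • x) := by
      rw [map_smul]; rfl
    rw [h1, hβ]
    refine Eq.trans ?_ (congrArg (fun f => f (c • e)) (hβ x)).symm
    rw [ha]
    change _ = u _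
    congr 1
    refine Subtype.ext ?_
    change MulOpposite.op (TrivSqZeroExt.inr e : RelationExtension k C) •
      MulOpposite.op (TrivSqZeroExt.inl c : RelationExtension k C) • x =
        MulOpposite.op (TrivSqZeroExt.inr (c • e) : RelationExtension k C) • x
    rw [← mul_smul, ← MulOpposite.op_mul, TrivSqZeroExt.inl_mul_inr]
  have hu : ∀ (x : p.P₀) (e : ExtBimodule k C),
      u ⟨MulOpposite.op (TrivSqZeroExt.inr e : RelationExtension k C) • x, hker x e⟩ = 0 :=
    fun x e => by rw [← ha, ← hβ, hβ0]; rfl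
  let d : (restriction k C).obj p.P₀ ⟶ M := ModuleCat.ofHom (X := (restriction k C).obj p.P₀) (Y := M)
    { toFun := fun x => p.d₀.hom x
      map_add' := map_add _
      map_smul' := fun c x =>
        map_smul p.d₀.hom (MulOpposite.op (TrivSqZeroExt.inl c.unop : RelationExtension k C)) x }
  let q' : M ⟶ (restriction k C).obj X :=
    ModuleCat.ofHom (X := M) (Y := (restriction k C).obj X)
    { toFun := fun x => q.hom x
      map_add' := map_add q.hom
      map_smul' := fun c x =>
        map_smul q.hom (MulOpposite.op (TrivSqZeroExt.inl c.unop : RelationExtension k C))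
          (show (inflation k C).obj M from x) }
  let u' : (kerComplex d).X₁ ⟶ (restriction k C).obj X :=
    ModuleCat.ofHom (X := (kerComplex d).X₁) (Y := (restriction k C).obj X)
    { toFun := fun x => u ⟨x.1, x.2⟩
      map_add' := fun x y => map_add u ⟨x.1, x.2⟩ ⟨y.1, y.2⟩
      map_smul' := fun c x => map_smul u
        (MulOpposite.op (TrivSqZeroExt.inl c.unop : RelationExtension k C)) ⟨x.1, x.2⟩ }
  -- The extension is found over `C`. It is `B`-linear because `v` agrees with `u` on `P₀ E`, where
  -- `u` vanishes, and `E` kills `X`.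
  obtain ⟨v, hv⟩ := exists_extension_of_subsingleton_ext (kerComplex_shortExact d p.surjective)
    (hext _ q' hq) u'
  have hv' : ∀ (x : p.P₀) (hx : x ∈ LinearMap.ker p.d₀.hom), v.hom x = u ⟨x, hx⟩ :=
    fun x hx => congrArg (fun f : (kerComplex d).X₁ ⟶ (restriction k C).obj X =>
      f.hom ⟨x, hx⟩) hv
  refine ⟨{ toFun := fun x => v.hom x
            map_add' := map_add v.hom
            map_smul' := fun b x => ?_ }, LinearMap.ext fun x => hv' x.1 x.2⟩
  obtain ⟨b, rfl⟩ := MulOpposite.op_surjective b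
  rw [op_smul_eq_add b x]
  refine (map_add v.hom _ _).trans ?_
  refine (congrArg (_ + ·) ((hv' _ (hker x b.snd)).trans (hu _ _))).trans ?_
  refine (add_zero _).trans ?_
  change _ = MulOpposite.op b • (show X from v.hom x)
  rw [op_smul_eq_add b (show X from v.hom x), hX, add_zero]
  exact map_smul v.hom (MulOpposite.op b.fst) (show (restriction k C).obj p.P₀ from x)

end TauRigidInflation

/-! ### Fitting's lemma and local endomorphism rings -/

section KrullSchmidt

variable {A : Type u} [Ring A]

theorem isZero_of_subsingleton_submodule {X : ModuleCat.{u} A} {N : Submodule A X}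
    (h : Limits.IsZero (ModuleCat.of A N)) : N = ⊥ :=
  (Submodule.subsingleton_iff_eq_bot).1 (ModuleCat.subsingleton_of_isZero h)

theorem nonempty_iso_biprod_of_isCompl {X : ModuleCat.{u} A} {p q : Submodule A X} (h : IsCompl p q) :
    Nonempty (X ≅ ModuleCat.of A p ⊞ ModuleCat.of A q) :=
  ⟨LinearEquiv.toModuleIso (X₁ := X) (Submodule.prodEquivOfIsCompl p q h).symm ≪≫
    (ModuleCat.biprodIsoProd (ModuleCat.of A p) (ModuleCat.of A q)).symm⟩

/-- Kernel and range of a high power of `f` are complementary, so one of them is zero. -/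
theorem isUnit_or_isNilpotent_of_indecomposable {X : ModuleCat.{u} A} [IsNoetherian A X]
    [IsArtinian A X] (hX : Indecomposable X) (f : Module.End A X) :
    IsUnit f ∨ IsNilpotent f := by
  obtain ⟨n, hn⟩ := Filter.eventually_atTop.1 (LinearMap.eventually_isCompl_ker_pow_range_pow f)
  have hc := hn (n + 1) (by lia)
  obtain ⟨e⟩ := nonempty_iso_biprod_of_isCompl hc
  rcases hX.2 _ _ e with h | h
  · left
    have hk := isZero_of_subsingleton_submodule h
    have hr : LinearMap.range (f ^ (n + 1)) = ⊤ := by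
      have := hc.sup_eq_top
      rwa [hk, bot_sup_eq] at this
    have hu : IsUnit (f ^ (n + 1)) :=
      (Module.End.isUnit_iff _).2 ⟨LinearMap.ker_eq_bot.1 hk, LinearMap.range_eq_top.1 hr⟩
    exact (isUnit_pow_iff (by lia)).1 hu
  · right
    exact ⟨n + 1, LinearMap.range_eq_bot.1 (isZero_of_subsingleton_submodule h)⟩

theorem nontrivial_of_indecomposable {X : ModuleCat.{u} A} (hX : Indecomposable X) :
    Nontrivial X := by
  by_contra h
  rw [not_nontrivial_iff_subsingleton] at h
  exact hX.1 (ModuleCat.isZero_of_subsingleton X)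

theorem isLocalRing_end_of_indecomposable {X : ModuleCat.{u} A} [IsNoetherian A X]
    [IsArtinian A X] (hX : Indecomposable X) : IsLocalRing (Module.End A X) := by
  have := nontrivial_of_indecomposable hX
  exact
    { isUnit_or_isUnit_of_add_one := fun {a b} hab => by
        rcases isUnit_or_isNilpotent_of_indecomposable hX a with h | h
        · exact Or.inl h
        · right
          rw [← eq_sub_iff_add_eq'] at hab
          exact hab ▸ h.isUnit_one_sub }

theorem isIso_of_isUnit_hom {X : ModuleCat.{u} A} {f : X ⟶ X} (h : IsUnit f.hom) : IsIso f := by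
  obtain ⟨g, h₁, h₂⟩ := isUnit_iff_exists.1 h
  exact ⟨ModuleCat.ofHom g, ModuleCat.hom_ext h₂, ModuleCat.hom_ext h₁⟩

theorem isUnit_hom_of_isIso {X : ModuleCat.{u} A} (f : X ⟶ X) [IsIso f] : IsUnit f.hom :=
  isUnit_iff_exists.2 ⟨(inv f).hom, congrArg ModuleCat.Hom.hom (IsIso.inv_hom_id f),
    congrArg ModuleCat.Hom.hom (IsIso.hom_inv_id f)⟩

theorem retract_of_isIso_comp {X Y : ModuleCat.{u} A} (i : X ⟶ Y) (r : Y ⟶ X) [IsIso (i ≫ r)] :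
    Nonempty (Retract X Y) :=
  ⟨⟨i, r ≫ inv (i ≫ r), by rw [← Category.assoc, IsIso.hom_inv_id]⟩⟩

theorem exists_isIso_of_sum_eq_id {X : ModuleCat.{u} A} [IsNoetherian A X] [IsArtinian A X]
    (hX : Indecomposable X) {n : ℕ} (f : Fin n → (X ⟶ X)) (h : ∑ i, f i = 𝟙 X) :
    ∃ i, IsIso (f i) := by
  have := isLocalRing_end_of_indecomposable hX
  have h' : IsUnit (∑ i, (f i).hom) := by
    rw [← ModuleCat.hom_sum, h, ModuleCat.hom_id]
    exact isUnit_one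
  obtain ⟨i, -, hi⟩ := IsLocalRing.exists_of_isUnit_sum h'
  exact ⟨i, isIso_of_isUnit_hom hi⟩

theorem comp_eq_sum_power {X Y M : ModuleCat.{u} A} {n : ℕ} (f : X ⟶ power M n)
    (g : power M n ⟶ Y) :
    f ≫ g = ∑ i, (f ≫ powerProj M n i) ≫ (powerIncl M n i ≫ g) := by
  conv_lhs => rw [← Category.id_comp g, ← sum_powerProj_powerIncl, Preadditive.sum_comp,
    Preadditive.comp_sum]
  simp

theorem retract_of_retract_power {X M : ModuleCat.{u} A} [IsNoetherian A X] [IsArtinian A X]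
    (hX : Indecomposable X) {n : ℕ} (r : Retract X (power M n)) : Nonempty (Retract X M) := by
  obtain ⟨i, hi⟩ := exists_isIso_of_sum_eq_id hX _ ((comp_eq_sum_power r.i r.r).symm.trans r.retract)
  exact retract_of_isIso_comp (r.i ≫ powerProj M n i) (powerIncl M n i ≫ r.r)

/-- The idempotent of `Y` cut out by the retraction is invertible, hence the identity, or nilpotent,
hence zero; the latter would make `X` zero. -/
theorem nonempty_iso_of_retract {X Y : ModuleCat.{u} A} [IsNoetherian A Y] [IsArtinian A Y]
    (hX : Indecomposable X) (hY : Indecomposable Y) (r : Retract X Y) : Nonempty (X ≅ Y) := by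
  have hidem : (r.r ≫ r.i) ≫ (r.r ≫ r.i) = r.r ≫ r.i := by simp
  rcases isUnit_or_isNilpotent_of_indecomposable hY (r.r ≫ r.i).hom with h | h
  · have := isIso_of_isUnit_hom h
    have h1 : r.r ≫ r.i = 𝟙 Y := by
      rw [← cancel_epi (r.r ≫ r.i), hidem, Category.comp_id]
    exact ⟨⟨r.i, r.r, r.retract, h1⟩⟩
  · exfalso
    have h2 : IsIdempotentElem (M := Module.End A Y) (r.r ≫ r.i).hom :=
      congrArg ModuleCat.Hom.hom hidem
    obtain ⟨n, hn⟩ := h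
    have h3 : r.r ≫ r.i = 0 := by
      refine ModuleCat.hom_ext ?_
      rcases n with _ | n
      · have : (1 : Module.End A Y) = 0 := by simpa using hn
        exact LinearMap.ext fun y => LinearMap.congr_fun
          (show (1 : Module.End A Y) * (r.r ≫ r.i).hom = 0 by rw [this, zero_mul]) y
      · rw [h2.pow_succ_eq] at hn
        exact hn
    apply hX.1
    rw [Limits.IsZero.iff_id_eq_zero, ← r.retract]
    have : r.i ≫ r.r = r.i ≫ (r.r ≫ r.i) ≫ r.r := by simp
    rw [this, h3]
    simp

end KrullSchmidt

/-! ### Additive functions on modules -/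

section AdditiveInvariants

variable {A : Type u} [Ring A] {V : Type*} [AddCommGroup V]

/-- A function on modules that is additive on short exact sequences of finitely generated
modules. -/
def IsAdditiveInvariant (f : ModuleCat.{u} A → V) : Prop :=
  ∀ S : ShortComplex (ModuleCat.{u} A), S.ShortExact → Module.Finite A S.X₂ →
    f S.X₂ = f S.X₁ + f S.X₃

namespace IsAdditiveInvariant

variable {f : ModuleCat.{u} A → V}

theorem of_subsingleton (hf : IsAdditiveInvariant f) (X : ModuleCat.{u} A) [Subsingleton X] :
    f X = 0 := by
  have hz := ModuleCat.isZero_of_subsingleton X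
  have hS : (ShortComplex.mk (0 : X ⟶ X) (0 : X ⟶ X) (by simp)).ShortExact :=
    ModuleCat.shortComplex_shortExact _
      (fun x => ⟨fun _ => ⟨0, Subsingleton.elim _ _⟩, fun _ => Subsingleton.elim _ _⟩)
      (fun _ _ _ => Subsingleton.elim (α := X) _ _) (fun _ => ⟨0, Subsingleton.elim (α := X) _ _⟩)
  simpa using hf _ hS (inferInstanceAs (Module.Finite A X))

theorem of_iso (hf : IsAdditiveInvariant f) {X Y : ModuleCat.{u} A} [hY : Module.Finite A Y]
    (e : X ≅ Y) : f X = f Y := by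
  have hS : (ShortComplex.mk e.hom (0 : Y ⟶ ModuleCat.of A PUnit.{u + 1}) (by simp)).ShortExact :=
    ModuleCat.shortComplex_shortExact _
      (fun x => ⟨fun _ => ⟨e.inv.hom x, by simp⟩, fun _ => rfl⟩)
      e.toLinearEquiv.injective (fun _ => ⟨0, Subsingleton.elim (α := PUnit) _ _⟩)
  have h := hf _ hS hY
  rw [of_subsingleton hf (ModuleCat.of A PUnit.{u + 1}), add_zero] at h
  exact h.symm

theorem of_quotient (hf : IsAdditiveInvariant f) {X : ModuleCat.{u} A} [hX : Module.Finite A X]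
    (N : Submodule A X) : f X = f (ModuleCat.of A N) + f (ModuleCat.of A (X ⧸ N)) :=
  hf _ (quotientComplex_shortExact N) hX

theorem of_biprod (hf : IsAdditiveInvariant f) {X Y Z : ModuleCat.{u} A} [Module.Finite A X]
    (e : X ≅ Y ⊞ Z) : f X = f Y + f Z := by
  have : Module.Finite A (Y ⊞ Z : ModuleCat A) := Module.Finite.equiv e.toLinearEquiv
  rw [of_iso hf e]
  exact hf _ (ShortComplex.Splitting.ofHasBinaryBiproduct Y Z).shortExact this

end IsAdditiveInvariant

/-- Every finitely generated module over an Artinian ring lies in the span of the simple modules,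
as far as additive invariants are concerned. -/
theorem mem_span_simple {K : Type*} [Field K] [Module K V] [IsArtinianRing A]
    [IsNoetherianRing A] {f : ModuleCat.{u} A → V} (hf : IsAdditiveInvariant f)
    {W : Submodule K V} (hW : ∀ S : ModuleCat.{u} A, IsSimpleModule A S → f S ∈ W)
    (X : ModuleCat.{u} A) [Module.Finite A X] : f X ∈ W := by
  have h : ∀ (Y : Type u) [AddCommGroup Y] [Module A Y], IsFiniteLength A Y →
      f (ModuleCat.of A Y) ∈ W := by
    intro Y _ _ hY
    induction hY with
    | @of_subsingleton Y _ _ _ =>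
      rw [hf.of_subsingleton (ModuleCat.of A Y)]
      exact W.zero_mem
    | @of_simple_quotient Y _ _ N hs hN ih =>
      have : IsFiniteLength A Y := .of_simple_quotient hN
      have := (isFiniteLength_iff_isNoetherian_isArtinian.1 this).1
      have : Module.Finite A (ModuleCat.of A Y) := inferInstanceAs (Module.Finite A Y)
      rw [hf.of_quotient (X := ModuleCat.of A Y) N]
      exact W.add_mem ih (hW _ hs)
  exact h X (isFiniteLength_iff_isNoetherian_isArtinian.2 ⟨inferInstance, inferInstance⟩)

/-- Induction on length: `X` is split until its pieces are indecomposable, and an indecomposable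
summand of `Mⁿ` is a summand of `M` because its endomorphism ring is local. -/
theorem mem_span_of_retract_power {K : Type*} [Field K] [Module K V] [IsArtinianRing A]
    [IsNoetherianRing A] {f : ModuleCat.{u} A → V} (hf : IsAdditiveInvariant f)
    {W : Submodule K V} {M : ModuleCat.{u} A}
    (hW : ∀ X : ModuleCat.{u} A, Indecomposable X → Nonempty (Retract X M) →
      Module.Finite A X → f X ∈ W)
    {n : ℕ} (X : ModuleCat.{u} A) [hX : Module.Finite A X] (r : Retract X (power M n)) :
    f X ∈ W := by
  obtain ⟨l, hl⟩ : ∃ l : ℕ, Module.length A X = l :=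
    ⟨_, (ENat.natCast_toNat (Module.length_ne_top (R := A) (M := X))).symm⟩
  induction l using Nat.strong_induction_on generalizing X with
  | _ l ih =>
    by_cases h0 : Limits.IsZero X
    · have := ModuleCat.subsingleton_of_isZero h0
      rw [hf.of_subsingleton X]
      exact W.zero_mem
    by_cases hi : Indecomposable X
    · exact hW X hi (retract_of_retract_power hi r) hX
    · have : ∃ (Y Z : ModuleCat.{u} A) (_ : X ≅ Y ⊞ Z), ¬ Limits.IsZero Y ∧ ¬ Limits.IsZero Z := by
        by_contra hne
        refine hi ⟨h0, fun Y Z e => ?_⟩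
        by_contra hne'
        rw [not_or] at hne'
        exact hne ⟨Y, Z, e, hne'.1, hne'.2⟩
      obtain ⟨Y, Z, e, hY, hZ⟩ := this
      let rY : Retract Y X := ⟨Limits.biprod.inl ≫ e.inv, e.hom ≫ Limits.biprod.fst, by simp⟩
      let rZ : Retract Z X := ⟨Limits.biprod.inr ≫ e.inv, e.hom ≫ Limits.biprod.snd, by simp⟩
      have fin : ∀ {Y : ModuleCat.{u} A}, Retract Y X → Module.Finite A Y := fun {Y} s =>
        Module.Finite.of_surjective s.r.hom fun y => ⟨s.i.hom y, by
          rw [← LinearMap.comp_apply, ← ModuleCat.hom_comp, s.retract]; rfl⟩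
      have := fin rY
      have := fin rZ
      have hadd : Module.length A X = Module.length A Y + Module.length A Z := by
        rw [← Module.length_prod]
        exact (e ≪≫ ModuleCat.biprodIsoProd Y Z).toLinearEquiv.length_eq
      have pos : ∀ {Y : ModuleCat.{u} A}, ¬ Limits.IsZero Y → 0 < Module.length A Y := fun {Y} h => by
        rw [pos_iff_ne_zero, Ne, Module.length_eq_zero_iff]
        exact fun h' => h (ModuleCat.isZero_of_subsingleton Y)
      obtain ⟨a, ha⟩ : ∃ a : ℕ, Module.length A Y = a :=
        ⟨_, (ENat.natCast_toNat (Module.length_ne_top (R := A) (M := Y))).symm⟩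
      obtain ⟨b, hb⟩ : ∃ b : ℕ, Module.length A Z = b :=
        ⟨_, (ENat.natCast_toNat (Module.length_ne_top (R := A) (M := Z))).symm⟩
      have pa := pos hY
      have pb := pos hZ
      rw [hl, ha, hb] at hadd
      rw [ha] at pa
      rw [hb] at pb
      norm_cast at hadd pa pb
      rw [hf.of_biprod e]
      exact W.add_mem (ih a (by lia) Y (rY.trans r) ha) (ih b (by lia) Z (rZ.trans r) hb)

/-- The common counting principle: vectors whose span contains a nonzero multiple of each unit
vector span `ℚ^ι`, so there are at least `|ι|` of them. -/
theorem card_le_encard_of_single_mem_span {ι β : Type*} [Fintype ι] [DecidableEq ι] (B : Set β)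
    (w : β → (ι → ℚ))
    (h : ∀ i, ∃ q : ℚ, q ≠ 0 ∧ Pi.single i q ∈ Submodule.span ℚ (w '' B)) :
    (Fintype.card ι : ℕ∞) ≤ B.encard := by
  rcases B.finite_or_infinite with hB | hB
  · have htop : Submodule.span ℚ (w '' B) = ⊤ := by
      rw [eq_top_iff]
      intro v _
      rw [← Finset.univ_sum_single v]
      refine Submodule.sum_mem _ fun i _ => ?_
      obtain ⟨q, hq, hi⟩ := h i
      have : Pi.single i (v i) = (v i / q) • (Pi.single i q : ι → ℚ) := by
        rw [← Pi.single_smul, smul_eq_mul, div_mul_cancel₀ _ hq]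
      rw [this]
      exact Submodule.smul_mem _ _ hi
    have h1 : Module.finrank ℚ (Submodule.span ℚ (w '' B)) ≤ (w '' B).ncard := by
      have := finrank_span_finset_le_card (R := ℚ) (hB.image w).toFinset
      rwa [Set.Finite.coe_toFinset, ← Set.ncard_eq_toFinset_card _ (hB.image w)] at this
    rw [htop, finrank_top, Module.finrank_fintype_fun_eq_card] at h1
    rw [← hB.cast_ncard_eq]
    exact_mod_cast h1.trans (Set.ncard_image_le hB)
  · rw [hB.encard_eq]
    exact le_top

end AdditiveInvariants

/-! ### Euler forms of modules of projective dimension at most one -/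

section EulerForm

variable (k : Type u) [Field k] {A : Type u} [Ring A] [Algebra k A]

theorem isAdditiveInvariant_finrank_hom [FiniteDimensional k A] (P : ModuleCat.{u} A)
    [Module.Finite A P] [Projective P] :
    IsAdditiveInvariant fun Y : ModuleCat.{u} A => (Module.finrank k (P ⟶ Y) : ℚ) := by
  intro S hS hfin
  have := IsNoetherianRing.of_finite k A
  have := hS.mono_f
  have := hS.epi_g
  have := finite_hom k P S.X₂
  have h1 := LinearMap.finrank_range_add_finrank_ker (Linear.rightComp k P S.g)
  have h2 : LinearMap.range (Linear.rightComp k P S.g) = ⊤ := by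
    rw [LinearMap.range_eq_top]
    exact fun φ => ⟨Projective.factorThru φ S.g, Projective.factorThru_comp φ S.g⟩
  have h3 : LinearMap.ker (Linear.rightComp k P S.g) = LinearMap.range (Linear.rightComp k P S.f) := by
    ext φ
    constructor
    · intro hφ
      obtain ⟨ψ, hψ⟩ := Limits.KernelFork.IsLimit.lift' hS.fIsKernel φ hφ
      exact ⟨ψ, hψ⟩
    · rintro ⟨ψ, rfl⟩
      change (ψ ≫ S.f) ≫ S.g = 0
      simp
  have h4 : Function.Injective (Linear.rightComp k P S.f) := fun a b hab => (cancel_mono S.f).1 hab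
  rw [h2, h3, finrank_top, LinearMap.finrank_range_of_inj h4] at h1
  beta_reduce
  rw [← h1]
  push_cast
  ring

/-- A projective resolution of length one by finitely generated modules. -/
structure ShortResolution (T : ModuleCat.{u} A) where
  P₁ : ModuleCat.{u} A
  P₀ : ModuleCat.{u} A
  d : P₁ ⟶ P₀
  p : P₀ ⟶ T
  zero : d ≫ p = 0
  shortExact : (ShortComplex.mk d p zero).ShortExact
  finite₁ : Module.Finite A P₁
  finite₀ : Module.Finite A P₀
  projective₁ : Projective P₁
  projective₀ : Projective P₀

theorem nonempty_shortResolution [IsNoetherianRing A] (T : ModuleCat.{u} A) [Module.Finite A T]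
    [h : HasProjectiveDimensionLT T 2] : Nonempty (ShortResolution T) := by
  obtain ⟨n, f, hf⟩ := exists_power_surjective T
  have hS := kerComplex_shortExact f hf
  have hp : Projective (power (ModuleCat.of A A) n) :=
    inferInstanceAs (Projective (ModuleCat.of A (Fin n → ModuleCat.of A A)))
  exact ⟨⟨_, _, _, f, (kerComplex f).zero, hS,
    inferInstanceAs (Module.Finite A (LinearMap.ker f.hom)),
    inferInstanceAs (Module.Finite A (Fin n → A)),
    projective_iff_hasProjectiveDimensionLT_one.2
      ((hS.hasProjectiveDimensionLT_X₃_iff 0 hp).1 h), hp⟩⟩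

variable {T : ModuleCat.{u} A} (R : ShortResolution T)

/-- The Euler form `dim Hom(T, Y) - dim Ext¹(T, Y)`, computed from a resolution of `T`. -/
def ShortResolution.euler (Y : ModuleCat.{u} A) : ℚ :=
  (Module.finrank k (R.P₀ ⟶ Y) : ℚ) - Module.finrank k (R.P₁ ⟶ Y)

theorem ShortResolution.isAdditiveInvariant_euler [FiniteDimensional k A] :
    IsAdditiveInvariant (R.euler k) := by
  intro S hS hfin
  have := R.finite₁
  have := R.finite₀
  have := R.projective₁
  have := R.projective₀
  have h₀ := isAdditiveInvariant_finrank_hom k R.P₀ S hS hfin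
  have h₁ := isAdditiveInvariant_finrank_hom k R.P₁ S hS hfin
  simp only at h₀ h₁
  simp only [euler, h₀, h₁]
  ring

/-- Rank-nullity turns the definition into kernel minus cokernel of `Hom(d, Y)`. The next two lemmas
detect when these vanish through `Hom(T, Y)` and `Ext¹(T, Y)`. -/
theorem ShortResolution.euler_eq [FiniteDimensional k A] (Y : ModuleCat.{u} A) [Module.Finite A Y] :
    R.euler k Y = Module.finrank k (LinearMap.ker (Linear.leftComp k Y R.d)) -
      (Module.finrank k (R.P₁ ⟶ Y) -
        Module.finrank k (LinearMap.range (Linear.leftComp k Y R.d))) := by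
  have := R.finite₀
  have := finite_hom k R.P₀ Y
  rw [euler, ← LinearMap.finrank_range_add_finrank_ker (Linear.leftComp k Y R.d)]
  push_cast
  ring

theorem ShortResolution.subsingleton_hom_iff (Y : ModuleCat.{u} A) :
    LinearMap.ker (Linear.leftComp k Y R.d) = ⊥ ↔ Subsingleton (T ⟶ Y) := by
  have := R.shortExact.epi_g
  have : Epi R.p := this
  rw [eq_bot_iff]
  constructor
  · intro h
    have h0 : ∀ φ : T ⟶ Y, φ = 0 := fun φ => by
      have : R.p ≫ φ = 0 := h (show R.d ≫ R.p ≫ φ = 0 by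
        rw [← Category.assoc, R.zero, Limits.zero_comp])
      rwa [← cancel_epi R.p, Limits.comp_zero]
    exact ⟨fun a b => (h0 a).trans (h0 b).symm⟩
  · intro h φ hφ
    obtain ⟨ψ, hψ⟩ := Limits.CokernelCofork.IsColimit.desc' R.shortExact.gIsCokernel φ hφ
    change φ = 0
    rw [← hψ, show ψ = 0 from h.elim _ _]
    exact Limits.comp_zero

theorem ShortResolution.subsingleton_ext_iff (Y : ModuleCat.{u} A) :
    LinearMap.range (Linear.leftComp k Y R.d) = ⊤ ↔ Subsingleton (Ext T Y 1) := by
  rw [LinearMap.range_eq_top]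
  constructor
  · intro h
    refine subsingleton_of_forall_eq_zero fun e => ?_
    have := R.projective₀
    obtain ⟨x, rfl⟩ := Ext.contravariant_sequence_exact₃ R.shortExact Y e
      (Ext.eq_zero_of_projective (P := R.P₀) _) (add_zero 1)
    obtain ⟨φ, rfl⟩ := (Ext.mk₀_bijective _ _).2 x
    obtain ⟨ψ, rfl⟩ := h φ
    change R.shortExact.extClass.comp (Ext.mk₀ (R.d ≫ ψ)) _ = 0
    rw [← Ext.mk₀_comp_mk₀]
    exact R.shortExact.extClass_comp_assoc _
  · intro h φ
    exact exists_extension_of_subsingleton_ext R.shortExact h φ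

theorem ShortResolution.euler_eq_zero [FiniteDimensional k A]
    {Y : ModuleCat.{u} A} [Module.Finite A Y]
    (h₀ : Subsingleton (T ⟶ Y)) (h₁ : Subsingleton (Ext T Y 1)) : R.euler k Y = 0 := by
  rw [R.euler_eq k, (R.subsingleton_hom_iff k Y).2 h₀, (R.subsingleton_ext_iff k Y).2 h₁,
    finrank_bot, finrank_top]
  simp

theorem ShortResolution.euler_ne_zero_of_hom [FiniteDimensional k A]
    {Y : ModuleCat.{u} A} [Module.Finite A Y]
    (h₀ : ¬ Subsingleton (T ⟶ Y)) (h₁ : Subsingleton (Ext T Y 1)) : R.euler k Y ≠ 0 := by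
  have := R.finite₀
  have := finite_hom k R.P₀ Y
  rw [R.euler_eq k, (R.subsingleton_ext_iff k Y).2 h₁, finrank_top, sub_self, sub_zero,
    Nat.cast_ne_zero, Ne, Submodule.finrank_eq_zero, R.subsingleton_hom_iff k]
  exact h₀

theorem ShortResolution.euler_ne_zero_of_ext [FiniteDimensional k A]
    {Y : ModuleCat.{u} A} [Module.Finite A Y]
    (h₀ : Subsingleton (T ⟶ Y)) (h₁ : ¬ Subsingleton (Ext T Y 1)) : R.euler k Y ≠ 0 := by
  have := R.finite₁
  have := finite_hom k R.P₁ Y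
  rw [R.euler_eq k, (R.subsingleton_hom_iff k Y).2 h₀, finrank_bot, Nat.cast_zero, zero_sub,
    neg_ne_zero, sub_ne_zero, Nat.cast_inj.ne]
  intro h
  exact h₁ ((R.subsingleton_ext_iff k Y).1 (Submodule.eq_top_of_finrank_eq h.symm))

end EulerForm

/-! ### Approximations by powers of `M` and orthogonal modules -/

section Approximation

variable (k : Type u) [Field k] {A : Type u} [Ring A] [Algebra k A] [FiniteDimensional k A]

/-- The components of `q` form a `k`-basis of `W`. -/
theorem exists_approximation (M X : ModuleCat.{u} A) [Module.Finite A M] [Module.Finite A X]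
    (W : Submodule k (M ⟶ X)) :
    ∃ (n : ℕ) (q : power M n ⟶ X), (∀ i, powerIncl M n i ≫ q ∈ W) ∧
      ∀ f ∈ W, ∃ g : M ⟶ power M n, g ≫ q = f := by
  have := finite_hom k M X
  let b := Module.finBasis k W
  let q : power M (Module.finrank k W) ⟶ X := ∑ i, powerProj M _ i ≫ (b i).1
  have hq : ∀ i, powerIncl M _ i ≫ q = (b i).1 := by
    intro i
    have : ∀ j, powerIncl M (Module.finrank k W) i ≫ powerProj M _ j =
        if i = j then 𝟙 M else 0 := by
      intro j
      split_ifs with h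
      · subst h
        exact ModuleCat.hom_ext (LinearMap.ext fun x => Pi.single_eq_same (M := fun _ => M) i x)
      · exact ModuleCat.hom_ext (LinearMap.ext fun x =>
          Pi.single_eq_of_ne (M := fun _ => M) (Ne.symm h) x)
    simp only [q, Preadditive.comp_sum, ← Category.assoc, this]
    rw [Finset.sum_eq_single i]
    · simp
    · intro j _ hj
      simp [Ne.symm hj]
    · simp
  refine ⟨_, q, fun i => by rw [hq]; exact (b i).2, fun f hf => ?_⟩
  refine ⟨∑ i, b.repr ⟨f, hf⟩ i • powerIncl M _ i, ?_⟩
  rw [Preadditive.sum_comp]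
  simp only [Linear.smul_comp, hq]
  have h := congrArg W.subtype (b.sum_repr ⟨f, hf⟩)
  rw [map_sum] at h
  exact h

theorem Generates.range {M X : ModuleCat.{u} A} {n : ℕ} (q : power M n ⟶ X) :
    Generates M (ModuleCat.of A (LinearMap.range q.hom)) :=
  ⟨n, ModuleCat.ofHom q.hom.rangeRestrict, q.hom.surjective_rangeRestrict⟩

end Approximation

section RadicalApproximation

variable {A : Type u} [Ring A]

/-- The maps `M ⟶ X` that are not split epimorphisms. -/
def nonSplitEpi (k : Type u) [Field k] [Algebra k A] (M : ModuleCat.{u} A) {X : ModuleCat.{u} A}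
    [IsNoetherian A X] [IsArtinian A X] (hX : Indecomposable X) : Submodule k (M ⟶ X) where
  carrier := {f | ∀ h : X ⟶ M, ¬ IsIso (h ≫ f)}
  zero_mem' h hi := by
    rw [Limits.comp_zero] at hi
    exact hX.1 (((Limits.isIsoZero_iff_source_target_isZero X X).1 hi).1)
  -- Closure under sums is locality of the endomorphism ring of `X`.
  add_mem' {f g} hf hg h hi := by
    have := isLocalRing_end_of_indecomposable hX
    have hu : IsUnit ((h ≫ f).hom + (h ≫ g).hom : Module.End A X) := by
      have := isUnit_hom_of_isIso (h ≫ (f + g))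
      rwa [Preadditive.comp_add] at this
    rcases IsLocalRing.isUnit_or_isUnit_of_isUnit_add hu with h' | h'
    · exact hf h (isIso_of_isUnit_hom h')
    · exact hg h (isIso_of_isUnit_hom h')
  smul_mem' c f hf h hi := hf (c • h) (by rwa [Linear.smul_comp, ← Linear.comp_smul])

/-- The maps `M ⟶ X` that are not split epimorphisms form a subspace, and `q` is its approximation.
A map to `X` from a summand `T ≇ X`, composed with the projection `M ⟶ T`, belongs to it, since
otherwise `X` would be a summand of `T`. -/
theorem exists_radical_approximation (k : Type u) [Field k] [Algebra k A] [FiniteDimensional k A]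
    (M X : ModuleCat.{u} A) [Module.Finite A M]
    [Module.Finite A X] (hX : Indecomposable X) :
    ∃ (n : ℕ) (q : power M n ⟶ X), (∀ g : X ⟶ power M n, g ≫ q ≠ 𝟙 X) ∧
      ∀ T : ModuleCat.{u} A, Indecomposable T → Nonempty (Retract T M) → IsEmpty (T ≅ X) →
        ∀ f : T ⟶ X, ∃ g : T ⟶ power M n, g ≫ q = f := by
  have := IsNoetherianRing.of_finite k A
  have := IsArtinianRing.of_finite k A
  obtain ⟨n, q, hq, hW⟩ := exists_approximation k M X (nonSplitEpi k M hX)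
  refine ⟨n, q, fun g hg => ?_, ?_⟩
  · obtain ⟨i, hi⟩ := exists_isIso_of_sum_eq_id hX _ ((comp_eq_sum_power g q).symm.trans hg)
    exact hq i _ hi
  · rintro T hT ⟨r⟩ hne f
    have hTfin : Module.Finite A T :=
      Module.Finite.of_surjective r.r.hom fun y => ⟨r.i.hom y, by
        rw [← LinearMap.comp_apply, ← ModuleCat.hom_comp, r.retract]; rfl⟩
    have hf : r.r ≫ f ∈ nonSplitEpi k M hX := fun h hi => by
      rw [← Category.assoc] at hi
      obtain ⟨s⟩ := retract_of_isIso_comp (h ≫ r.r) f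
      obtain ⟨e⟩ := nonempty_iso_of_retract hX hT s
      exact hne.false e.symm
    obtain ⟨g, hg⟩ := hW _ hf
    exact ⟨r.i ≫ g, by rw [Category.assoc, hg, ← Category.assoc, r.retract, Category.id_comp]⟩

theorem subsingleton_hom_quotient_range {M X T : ModuleCat.{u} A} {n : ℕ}
    (q : power M n ⟶ X)
    (h : Subsingleton (Ext T (ModuleCat.of A (LinearMap.range q.hom)) 1))
    (hl : ∀ f : T ⟶ X, ∃ g : T ⟶ power M n, g ≫ q = f) :
    Subsingleton (T ⟶ ModuleCat.of A (X ⧸ LinearMap.range q.hom)) := by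
  have h0 : ∀ f : T ⟶ ModuleCat.of A (X ⧸ LinearMap.range q.hom), f = 0 := fun f => by
    obtain ⟨f', rfl⟩ := exists_lift_of_subsingleton_ext
      (quotientComplex_shortExact (LinearMap.range q.hom)) h f
    obtain ⟨g, rfl⟩ := hl f'
    exact ModuleCat.hom_ext (LinearMap.ext fun x =>
      (Submodule.Quotient.mk_eq_zero _).2 ⟨g.hom x, rfl⟩)
  exact ⟨fun a b => (h0 a).trans (h0 b).symm⟩

/-- Let `q : Mⁿ ⟶ X` be the radical approximation. If `q` is not onto, `Y = X / im q` works: `Ext¹`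
vanishes because `M` generates `Y`, and `X ⟶ Y` is nonzero. If `q` is onto with kernel `K`, take `Y`
to be `K` modulo the trace of `M` in it. All `Hom` to `Y` then vanish, and `Ext¹(T, Y) = 0` for `T ≇
X` because maps `T ⟶ X` lift through `q`. But `Ext¹(X, Y) = 0` would give `Ext¹(X, K) = 0` and split
`q`. -/
theorem exists_ext_orthogonal (k : Type u) [Field k] [Algebra k A] [FiniteDimensional k A]
    {M X : ModuleCat.{u} A} [Module.Finite A M] [Module.Finite A X]
    (h₂ : ∀ Y, Subsingleton (Ext M Y 2)) (h₁ : Subsingleton (Ext M M 1))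
    (hX : Indecomposable X) (hXM : Nonempty (Retract X M)) :
    ∃ Y : ModuleCat.{u} A, Module.Finite A Y ∧
      (∀ T : ModuleCat.{u} A, Indecomposable T → Nonempty (Retract T M) → IsEmpty (T ≅ X) →
        Subsingleton (T ⟶ Y) ∧ Subsingleton (Ext T Y 1)) ∧
      ((¬ Subsingleton (X ⟶ Y) ∧ Subsingleton (Ext X Y 1)) ∨
        (Subsingleton (X ⟶ Y) ∧ ¬ Subsingleton (Ext X Y 1))) := by
  have := IsNoetherianRing.of_finite k A
  obtain ⟨n, q, hid, hq⟩ := exists_radical_approximation k M X hX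
  have hgen : ∀ {T Y : ModuleCat.{u} A}, Nonempty (Retract T M) → Generates M Y →
      Subsingleton (Ext T Y 1) := fun {T Y} ⟨r⟩ hY =>
    subsingleton_ext_of_retract_left r (subsingleton_ext_one_of_generates h₂ h₁ hY)
  by_cases hs : Function.Surjective q.hom
  · obtain ⟨m, q', -, hq'⟩ :=
      exists_approximation k M (ModuleCat.of A (LinearMap.ker q.hom)) ⊤
    have hhom : ∀ T : ModuleCat.{u} A, Nonempty (Retract T M) →
        Subsingleton (T ⟶ ModuleCat.of A (LinearMap.ker q.hom ⧸ LinearMap.range q'.hom)) := by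
      rintro T ⟨r⟩
      refine subsingleton_hom_quotient_range q' (hgen ⟨r⟩ (.range q')) fun f => ?_
      obtain ⟨g, hg⟩ := hq' (r.r ≫ f) trivial
      exact ⟨r.i ≫ g, by rw [Category.assoc, hg, ← Category.assoc, r.retract, Category.id_comp]⟩
    have hS := quotientComplex_shortExact (X := ModuleCat.of A (LinearMap.ker q.hom))
      (LinearMap.range q'.hom)
    refine ⟨ModuleCat.of A (LinearMap.ker q.hom ⧸ LinearMap.range q'.hom),
      inferInstanceAs (Module.Finite A (LinearMap.ker q.hom ⧸ LinearMap.range q'.hom)),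
      fun T hT hTM hne => ⟨hhom T hTM, ?_⟩, Or.inr ⟨hhom X hXM, fun hext => ?_⟩⟩
    · have hK := subsingleton_ext_one_of_lift (T := T) (kerComplex_shortExact q hs)
        (hgen hTM ⟨n, 𝟙 _, Function.surjective_id⟩) (hq T hT hTM hne)
      obtain ⟨r⟩ := hTM
      exact subsingleton_ext_X₃ hS hK (subsingleton_ext_of_retract_left r (h₂ _))
    · have hK := subsingleton_ext_X₂ hS (hgen hXM (.range q')) hext
      obtain ⟨g, hg⟩ := exists_lift_of_subsingleton_ext (kerComplex_shortExact q hs) hK (𝟙 X)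
      exact hid g hg
  · obtain ⟨r⟩ := hXM
    have hsurj : Function.Surjective r.r.hom := fun y => ⟨r.i.hom y, by
      rw [← LinearMap.comp_apply, ← ModuleCat.hom_comp, r.retract]; rfl⟩
    have hY : Generates M (ModuleCat.of A (X ⧸ LinearMap.range q.hom)) :=
      ⟨1, powerProj M 1 0 ≫ r.r ≫ ModuleCat.ofHom (LinearMap.range q.hom).mkQ,
        (Submodule.mkQ_surjective _).comp (hsurj.comp fun x => ⟨fun _ => x, rfl⟩)⟩
    refine ⟨ModuleCat.of A (X ⧸ LinearMap.range q.hom),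
      inferInstanceAs (Module.Finite A (X ⧸ LinearMap.range q.hom)),
      fun T hT hTM hne => ⟨subsingleton_hom_quotient_range q (hgen hTM (.range q))
        (hq T hT hTM hne), hgen hTM hY⟩, Or.inl ⟨fun hsub => hs ?_, hgen ⟨r⟩ hY⟩⟩
    have h0 : ModuleCat.ofHom (X := X) (LinearMap.range q.hom).mkQ = 0 := hsub.elim _ _
    rw [← LinearMap.range_eq_top, eq_top_iff]
    intro x _
    exact (Submodule.Quotient.mk_eq_zero _).1 (LinearMap.congr_fun (congrArg ModuleCat.Hom.hom h0) x)

end RadicalApproximation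

/-! ### At most as many indecomposable summands as simples -/

section Counting

theorem encard_le_of_forall_finset {β : Type*} {S : Set β} {N : ℕ∞}
    (h : ∀ F : Finset β, ↑F ⊆ S → (F.card : ℕ∞) ≤ N) : S.encard ≤ N := by
  by_contra! hlt
  obtain ⟨t, hts, ht⟩ := Set.exists_subset_encard_eq (Order.add_one_le_of_lt hlt)
  have hN : N ≠ ⊤ := hlt.ne_top
  have hfin : t.Finite := by
    rw [← Set.encard_ne_top_iff, ht]
    exact WithTop.add_ne_top.2 ⟨hN, ENat.one_ne_top⟩
  have := h hfin.toFinset (by simpa using hts)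
  rw [← Set.encard_coe_eq_coe_finsetCard, hfin.coe_toFinset, ht] at this
  exact absurd this (not_le.2 ((ENat.lt_add_one_iff hN).2 le_rfl))

variable {Λ : Type u} [Ring Λ]

theorem finite_of_retract {M X : RightMod Λ} [Module.Finite Λᵐᵒᵖ M] (r : Retract X M) :
    Module.Finite Λᵐᵒᵖ X :=
  Module.Finite.of_surjective r.r.hom fun y => ⟨r.i.hom y, by
    rw [← LinearMap.comp_apply, ← ModuleCat.hom_comp, r.retract]; rfl⟩

/-- Send `Y` to its vector of Euler forms against the summands `T i`. The module orthogonal to all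
summands but one gives a nonzero multiple of a unit vector, and by additivity all these vectors are
spanned by those of the simples. -/
theorem encard_indecomposableSummands_le (k : Type u) [Field k] [Algebra k Λ]
    [FiniteDimensional k Λ] {M : RightMod Λ} (hM : IsPartialTilting M) :
    (indecomposableSummands M).encard ≤ (simpleClasses Λ).encard := by
  classical
  have := IsNoetherianRing.of_finite k Λᵐᵒᵖ
  have := IsArtinianRing.of_finite k Λᵐᵒᵖ
  have := hM.finite
  have h2 : HasProjectiveDimensionLT M 2 := (projectiveDimension_le_iff M 1).1 hM.2
  refine encard_le_of_forall_finset fun F hF => ?_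
  choose T hT hTM hTc using fun i : F => hF i.2
  have hfin : ∀ i, Module.Finite Λᵐᵒᵖ (T i) := fun i => finite_of_retract (hTM i).some
  have hpd : ∀ i, HasProjectiveDimensionLT (T i) 2 := fun i =>
    (hTM i).some.hasProjectiveDimensionLT 2
  have R : ∀ i, ShortResolution (T i) := fun i => (nonempty_shortResolution (T i)).some
  let v : RightMod Λ → F → ℚ := fun Y i => (R i).euler k Y
  have hv : IsAdditiveInvariant v := fun S hS hfin =>
    funext fun i => (R i).isAdditiveInvariant_euler k S hS hfin
  rw [← Fintype.card_coe]
  refine card_le_encard_of_single_mem_span _ (fun c => v c.out) fun i => ?_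
  obtain ⟨Y, hY, hne, hi⟩ := exists_ext_orthogonal k (M := M) (X := T i)
    (fun Y => HasProjectiveDimensionLT.subsingleton M 2 2 le_rfl Y) hM.ext_self (hT i) (hTM i)
  refine ⟨v Y i, ?_, ?_⟩
  · rcases hi with ⟨h, h'⟩ | ⟨h, h'⟩
    · exact (R i).euler_ne_zero_of_hom k h h'
    · exact (R i).euler_ne_zero_of_ext k h h'
  · have : Pi.single i (v Y i) = v Y := by
      funext j
      by_cases hj : j = i
      · subst hj
        exact Pi.single_eq_same _ _
      · rw [Pi.single_eq_of_ne hj]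
        obtain ⟨h, h'⟩ := hne (T j) (hT j) (hTM j) ⟨fun e => hj (Subtype.ext (by
          rw [hTc j, hTc i]
          exact Quotient.sound ⟨e⟩))⟩
        exact ((R j).euler_eq_zero k h h').symm
    rw [this]
    refine mem_span_simple hv (fun S hS => Submodule.subset_span ?_) Y
    refine ⟨Quotient.mk _ S, ⟨S, hS, rfl⟩, ?_⟩
    obtain ⟨e⟩ := Quotient.mk_out (s := isIsomorphicSetoid (RightMod Λ)) S
    exact hv.of_iso e

end Counting

/-! ### Simple modules and their projective covers -/

section SimpleModules

variable {A : Type u} [Ring A]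

theorem finite_of_isSimpleModule (S : ModuleCat.{u} A) [IsSimpleModule A S] :
    Module.Finite A S := by
  have : Nontrivial S := IsSimpleModule.nontrivial A S
  obtain ⟨x, hx⟩ := exists_ne (0 : S)
  exact Module.Finite.of_surjective (LinearMap.toSpanSingleton A S x)
    (IsSimpleModule.toSpanSingleton_surjective A hx)

/-- The kernel of a nonzero `P ⟶ S'` is maximal and differs from `ker f`, so the two sum to `P`,
against superfluity. -/
theorem subsingleton_hom_of_superfluous_ker {P S S' : ModuleCat.{u} A} [IsSimpleModule A S]
    [IsSimpleModule A S'] (f : P ⟶ S) (hf : Function.Surjective f.hom)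
    (h : ∀ N : Submodule A P, N ⊔ LinearMap.ker f.hom = ⊤ → N = ⊤) (hne : IsEmpty (S ≅ S')) :
    Subsingleton (P ⟶ S') := by
  have h0 : ∀ g : P ⟶ S', g = 0 := fun g => by
    by_contra hg
    have hg0 : g.hom ≠ 0 := fun h => hg (ModuleCat.hom_ext h)
    have hgs : Function.Surjective g.hom := LinearMap.surjective_of_ne_zero hg0
    have eS := f.hom.quotKerEquivOfSurjective hf
    have eS' := g.hom.quotKerEquivOfSurjective hgs
    have hm : IsCoatom (LinearMap.ker f.hom) :=
      isSimpleModule_iff_isCoatom.1 (IsSimpleModule.congr eS)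
    have hm' : IsCoatom (LinearMap.ker g.hom) :=
      isSimpleModule_iff_isCoatom.1 (IsSimpleModule.congr eS')
    by_cases hk : LinearMap.ker f.hom = LinearMap.ker g.hom
    · exact hne.false (LinearEquiv.toModuleIso (X₁ := S) (X₂ := S')
        (eS.symm ≪≫ₗ Submodule.quotEquivOfEq _ _ hk ≪≫ₗ eS'))
    · exact hm'.1 (h _ ((hm.codisjoint_of_ne hm' hk).symm.eq_top))
  exact ⟨fun a b => (h0 a).trans (h0 b).symm⟩

end SimpleModules

/-! ### At least as many indecomposable summands as simples -/

section GeneratedByTilting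

theorem Generates.of_surjective {A : Type u} [Ring A] {M X Y : ModuleCat.{u} A}
    (h : Generates M X) (f : X ⟶ Y) (hf : Function.Surjective f.hom) : Generates M Y := by
  obtain ⟨n, q, hq⟩ := h
  exact ⟨n, q ≫ f, hf.comp hq⟩

theorem exists_lift_power {A : Type u} [Ring A] {M X Z : ModuleCat.{u} A} {q : Z ⟶ X}
    (h : ∀ f : M ⟶ X, ∃ g : M ⟶ Z, g ≫ q = f) {n : ℕ} (f : power M n ⟶ X) :
    ∃ g : power M n ⟶ Z, g ≫ q = f := by
  choose g hg using fun i => h (powerIncl M n i ≫ f)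
  refine ⟨∑ i, powerProj M n i ≫ g i, ?_⟩
  rw [← Category.id_comp f, ← sum_powerProj_powerIncl, Preadditive.sum_comp,
    Preadditive.sum_comp]
  simp [hg]

variable {C : Type u} [Ring C]

theorem Generates.exists_kernel (k : Type u) [Field k] [Algebra k C] [FiniteDimensional k C]
    {M X : RightMod C} [Module.Finite Cᵐᵒᵖ M] [Module.Finite Cᵐᵒᵖ X]
    (h₁ : Subsingleton (Ext M M 1)) (h : Generates M X) :
    ∃ (n : ℕ) (q : power M n ⟶ X), Function.Surjective q.hom ∧
      Subsingleton (Ext M (ModuleCat.of Cᵐᵒᵖ (LinearMap.ker q.hom)) 1) := by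
  obtain ⟨n, q, -, hq⟩ := exists_approximation k M X ⊤
  have hs : Function.Surjective q.hom := by
    obtain ⟨m, p, hp⟩ := h
    obtain ⟨g, rfl⟩ := exists_lift_power (fun f => hq f trivial) p
    exact Function.Surjective.of_comp (g := g.hom) hp
  exact ⟨n, q, hs, subsingleton_ext_one_of_lift (kerComplex_shortExact q hs)
    (subsingleton_ext_power_right n h₁) fun f => hq f trivial⟩

/-- For `x ∈ X`, the map `C ⟶ X`, `c ↦ x c`, extends to `T'` because `Ext¹(T'', X) = 0`. As `T'` is
a summand of a power of `M`, the extension factors through the approximation `q`, whose image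
therefore contains `x`. -/
theorem IsTilting.generates (k : Type u) [Field k] [Algebra k C] [FiniteDimensional k C]
    {M X : RightMod C} (hM : IsTilting M) [Module.Finite Cᵐᵒᵖ X]
    (h : Subsingleton (Ext M X 1)) : Generates M X := by
  have := hM.finite
  obtain ⟨n, q, -, hq⟩ := exists_approximation k M X ⊤
  refine ⟨n, q, fun x => ?_⟩
  obtain ⟨S, hS, ⟨e⟩, ⟨m, ⟨r⟩⟩, ⟨l, ⟨s⟩⟩⟩ := hM.coresolution
  obtain ⟨g, hg⟩ := exists_extension_of_subsingleton_ext hS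
    (subsingleton_ext_of_retract_left s (subsingleton_ext_power_left l h)) (e.hom ≫ orbitMap x)
  obtain ⟨g', hg'⟩ := exists_lift_power (fun f => hq f trivial) (r.r ≫ g)
  have h2 : e.inv ≫ S.f ≫ r.i ≫ g' ≫ q = orbitMap x := by
    rw [hg', r.retract_assoc, hg, e.inv_hom_id_assoc]
  refine ⟨(e.inv ≫ S.f ≫ r.i ≫ g').hom (1 : C), ?_⟩
  have h3 := LinearMap.congr_fun (congrArg ModuleCat.Hom.hom h2) (1 : C)
  exact h3.trans (by rw [orbitMap_apply, MulOpposite.op_one, one_smul])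

theorem IsTilting.subsingleton_ext_two {M : RightMod C} (hM : IsTilting M) (Y : RightMod C) :
    Subsingleton (Ext M Y 2) :=
  have : HasProjectiveDimensionLT M 2 := (projectiveDimension_le_iff M 1).1 hM.projectiveDimension_le
  HasProjectiveDimensionLT.subsingleton M 2 2 le_rfl Y

theorem IsTilting.subsingleton_ext_one {M X : RightMod C} (hM : IsTilting M)
    (h : Generates M X) : Subsingleton (Ext M X 1) :=
  subsingleton_ext_one_of_generates hM.subsingleton_ext_two hM.ext_self h

theorem IsTilting.generates_power_dualRegular (k : Type u) [Field k] [Algebra k C]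
    [FiniteDimensional k C] {M : RightMod C} (hM : IsTilting M) (n : ℕ) :
    Generates M (power (dualRegular k C) n) := by
  have : Module.Finite Cᵐᵒᵖ (power (dualRegular k C) n) :=
    inferInstanceAs (Module.Finite Cᵐᵒᵖ (Fin n → dualRegular k C))
  exact IsTilting.generates k hM (subsingleton_ext_power_right n
    (subsingleton_of_forall_eq_zero fun e => e.eq_zero_of_injective))

variable {K V : Type*} [Field K] [AddCommGroup V] [Module K V] {f : RightMod C → V}

/-- Approximating `X` three times gives successive kernels `K₁`, `K₂`, `K₃`. Dimension shifting from
`Ext³(X, K₃) = 0` gives `Ext²(K₁, K₃) = 0` and then `Ext¹(K₂, K₃) = 0`. The third sequence splits,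
so `K₂` is a summand of a power of `M`, and additivity recovers `K₁` and `X`. -/
theorem IsTilting.mem_span_of_generates (k : Type u) [Field k] [Algebra k C] [FiniteDimensional k C]
    {M : RightMod C} (hM : IsTilting M)
    (hC : globalDimension C = 2) (hf : IsAdditiveInvariant f) {W : Submodule K V}
    (hW : ∀ X : RightMod C, Indecomposable X → Nonempty (Retract X M) →
      Module.Finite Cᵐᵒᵖ X → f X ∈ W) (X : RightMod C) [Module.Finite Cᵐᵒᵖ X]
    (hX : Generates M X) : f X ∈ W := by
  have := IsNoetherianRing.of_finite k Cᵐᵒᵖ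
  have := IsArtinianRing.of_finite k Cᵐᵒᵖ
  have := hM.finite
  have hfin : ∀ {Y Z : RightMod C} [Module.Finite Cᵐᵒᵖ Y] (q : Y ⟶ Z),
      Module.Finite Cᵐᵒᵖ (ModuleCat.of Cᵐᵒᵖ (LinearMap.ker q.hom)) := fun {Y Z} _ q =>
    inferInstanceAs (Module.Finite Cᵐᵒᵖ (LinearMap.ker q.hom))
  have hpow : ∀ n, Module.Finite Cᵐᵒᵖ (power M n) := fun n =>
    inferInstanceAs (Module.Finite Cᵐᵒᵖ (Fin n → M))
  have hpW : ∀ n, f (power M n) ∈ W := fun n =>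
    mem_span_of_retract_power hf hW (power M n) (Retract.refl _)
  obtain ⟨a, q₁, hq₁, h₁⟩ := Generates.exists_kernel k hM.ext_self hX
  obtain ⟨b, q₂, hq₂, h₂⟩ := Generates.exists_kernel k hM.ext_self (IsTilting.generates k hM h₁)
  obtain ⟨c, q₃, hq₃, h₃⟩ := Generates.exists_kernel k hM.ext_self (IsTilting.generates k hM h₂)
  have S₁ := kerComplex_shortExact q₁ hq₁
  have S₂ := kerComplex_shortExact q₂ hq₂
  have S₃ := kerComplex_shortExact q₃ hq₃
  have e₁ := subsingleton_ext_of_X₁ (n := 2) S₁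
    (subsingleton_ext_power_left a (hM.subsingleton_ext_two _))
    (subsingleton_ext_three hC X (kerComplex q₃).X₁)
  have e₂ := subsingleton_ext_of_X₁ (n := 1) S₂ (subsingleton_ext_power_left b h₃) e₁
  obtain ⟨g, hg⟩ := exists_lift_of_subsingleton_ext S₃ e₂ (𝟙 _)
  have m₂ : f (kerComplex q₂).X₁ ∈ W := mem_span_of_retract_power hf hW _ ⟨g, q₃, hg⟩
  have i₁ := hf _ S₁ (hpow a)
  have i₂ := hf _ S₂ (hpow b)
  have m₁ : f (kerComplex q₁).X₁ ∈ W := by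
    have : f (kerComplex q₁).X₁ = f (power M b) - f (kerComplex q₂).X₁ :=
      eq_sub_of_add_eq' i₂.symm
    rw [this]
    exact W.sub_mem (hpW b) m₂
  have : f X = f (power M a) - f (kerComplex q₁).X₁ := eq_sub_of_add_eq' i₁.symm
  rw [this]
  exact W.sub_mem (hpW a) m₁

/-- `Y` embeds in some `DCⁿ`; both `DCⁿ` and the quotient are generated by `M`. -/
theorem IsTilting.mem_span (k : Type u) [Field k] [Algebra k C] [FiniteDimensional k C]
    {M : RightMod C} (hM : IsTilting M)
    (hC : globalDimension C = 2) (hf : IsAdditiveInvariant f) {W : Submodule K V}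
    (hW : ∀ X : RightMod C, Indecomposable X → Nonempty (Retract X M) →
      Module.Finite Cᵐᵒᵖ X → f X ∈ W) (Y : RightMod C) [Module.Finite Cᵐᵒᵖ Y] : f Y ∈ W := by
  obtain ⟨n, i, hi⟩ := exists_injective_power_dualRegular k Y
  have hfin : Module.Finite Cᵐᵒᵖ (power (dualRegular k C) n) :=
    inferInstanceAs (Module.Finite Cᵐᵒᵖ (Fin n → dualRegular k C))
  have hgen := IsTilting.generates_power_dualRegular k hM n
  have hS : (ShortComplex.mk i (ModuleCat.ofHom (LinearMap.range i.hom).mkQ)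
      (by ext x; simp)).ShortExact :=
    ModuleCat.shortComplex_shortExact _ (LinearMap.exact_map_mkQ_range i.hom) hi
      (Submodule.mkQ_surjective _)
  have : Module.Finite Cᵐᵒᵖ (ModuleCat.of Cᵐᵒᵖ
      (power (dualRegular k C) n ⧸ LinearMap.range i.hom)) :=
    inferInstanceAs (Module.Finite Cᵐᵒᵖ (power (dualRegular k C) n ⧸ LinearMap.range i.hom))
  have h := hf _ hS hfin
  rw [eq_sub_of_add_eq h.symm]
  exact W.sub_mem (IsTilting.mem_span_of_generates k hM hC hf hW _ hgen)
    (IsTilting.mem_span_of_generates k hM hC hf hW _ (hgen.of_surjective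
      (ModuleCat.ofHom (LinearMap.range i.hom).mkQ) (Submodule.mkQ_surjective _)))

/-- The vectors `(dim Hom(P i, Y))_i`, with `P i` a projective cover of the simple `S i`, send each
simple to a nonzero multiple of a unit vector. They are spanned by the vectors of the summands of
`M`. -/
theorem IsTilting.encard_simpleClasses_le (k : Type u) [Field k] [Algebra k C] [FiniteDimensional k C]
    {M : RightMod C} (hM : IsTilting M)
    (hC : globalDimension C = 2) :
    (simpleClasses C).encard ≤ (indecomposableSummands M).encard := by
  classical
  have := IsNoetherianRing.of_finite k Cᵐᵒᵖ
  have := IsArtinianRing.of_finite k Cᵐᵒᵖ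
  refine encard_le_of_forall_finset fun F hF => ?_
  choose S hS hSc using fun i : F => hF i.2
  have hfin : ∀ i, Module.Finite Cᵐᵒᵖ (S i) := fun i => finite_of_isSimpleModule (S i)
  choose P p hP hP' hp hps using fun i => exists_projective_cover (S i)
  have hproj : ∀ i, Projective (P i) := fun i => (IsProjective.iff_projective (P i)).1 (hP' i)
  let v : RightMod C → F → ℚ := fun Y i => Module.finrank k (P i ⟶ Y)
  have hv : IsAdditiveInvariant v := fun S hS hfin =>
    funext fun i => isAdditiveInvariant_finrank_hom k (P i) S hS hfin
  rw [← Fintype.card_coe]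
  refine card_le_encard_of_single_mem_span _ (fun c => v c.out) fun i => ⟨v (S i) i, ?_, ?_⟩
  · have := finite_hom k (P i) (S i)
    have hne : Nontrivial (P i ⟶ S i) := ⟨p i, 0, fun h0 => by
      have := IsSimpleModule.nontrivial Cᵐᵒᵖ (S i)
      obtain ⟨x, hx⟩ := exists_ne (0 : S i)
      obtain ⟨y, rfl⟩ := hp i x
      exact hx (by rw [h0]; rfl)⟩
    exact Nat.cast_ne_zero.2 (Module.finrank_pos (R := k) (M := P i ⟶ S i)).ne'
  · have : Pi.single i (v (S i) i) = v (S i) := by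
      funext j
      by_cases hj : j = i
      · subst hj
        exact Pi.single_eq_same _ _
      · rw [Pi.single_eq_of_ne hj]
        have := subsingleton_hom_of_superfluous_ker (S' := S i) (p j) (hp j) (hps j)
          ⟨fun e => hj (Subtype.ext (by
            rw [hSc j, hSc i]
            exact Quotient.sound ⟨e⟩))⟩
        exact (Nat.cast_eq_zero (R := ℚ).2
          (Module.finrank_zero_of_subsingleton (R := k) (M := P j ⟶ S i))).symm
    rw [this]
    refine IsTilting.mem_span k hM hC hv (fun X hX hXM hXfin => Submodule.subset_span ?_) (S i)
    refine ⟨Quotient.mk _ X, ⟨X, hX, hXM, rfl⟩, ?_⟩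
    obtain ⟨e⟩ := Quotient.mk_out (s := isIsomorphicSetoid (RightMod C)) X
    exact hv.of_iso e

end GeneratedByTilting

/-! ### Simples and indecomposable summands under inflation -/

section InflationClasses

variable {k : Type u} [Field k] {C : Type u} [Ring C] [Algebra k C]

instance full_inflation : (inflation k C).Full where
  map_surjective {X Y} f :=
    ⟨ModuleCat.ofHom (X := X) (Y := Y)
      { toFun := fun x => f.hom x
        map_add' := fun x y => f.hom.map_add x y
        map_smul' := fun c x =>
          f.hom.map_smul (MulOpposite.op (TrivSqZeroExt.inl c.unop : RelationExtension k C)) x },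
      rfl⟩

theorem isZero_inflation_iff (X : RightMod C) :
    Limits.IsZero ((inflation k C).obj X) ↔ Limits.IsZero X := by
  rw [ModuleCat.isZero_iff_subsingleton, ModuleCat.isZero_iff_subsingleton]
  rfl

/-- The modules over the relation extension that are annihilated by `E`. -/
def IsKilled (Y : RightMod (RelationExtension k C)) : Prop :=
  ∀ (y : Y) (e : ExtBimodule k C),
    MulOpposite.op (TrivSqZeroExt.inr e : RelationExtension k C) • y = 0

theorem isKilled_inflation (X : RightMod C) : IsKilled ((inflation k C).obj X) :=
  fun x e => inflation_inr_smul X e x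

theorem IsKilled.of_retract {X Y : RightMod (RelationExtension k C)} (hY : IsKilled Y)
    (r : Retract X Y) : IsKilled X := fun x e => by
  have hx : r.r.hom (r.i.hom x) = x := by
    rw [← LinearMap.comp_apply, ← ModuleCat.hom_comp, r.retract]; rfl
  rw [← hx, ← map_smul, hY, map_zero]

theorem IsKilled.exists_iso {Y : RightMod (RelationExtension k C)} (hY : IsKilled Y) :
    ∃ X : RightMod C, Nonempty ((inflation k C).obj X ≅ Y) := by
  let X := (restriction k C).obj Y
  let e : (inflation k C).obj X ≃ₗ[(RelationExtension k C)ᵐᵒᵖ] Y :=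
    { toFun := fun y => y
      invFun := fun y => y
      map_add' := fun _ _ => rfl
      map_smul' := fun b y => by
        have h := op_smul_eq_add b.unop (show Y from y)
        rw [hY, add_zero] at h
        exact h.symm
      left_inv := fun _ => rfl
      right_inv := fun _ => rfl }
  exact ⟨X, ⟨LinearEquiv.toModuleIso e⟩⟩

/-- Since `E² = 0`, the elements killed by `E` form a submodule containing `Y E`. If it is zero, so
is `Y E`; otherwise it is all of `Y`. -/
theorem isKilled_of_isSimpleModule (Y : RightMod (RelationExtension k C))
    [IsSimpleModule (RelationExtension k C)ᵐᵒᵖ Y] : IsKilled Y := by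
  let N : Submodule (RelationExtension k C)ᵐᵒᵖ Y :=
    { carrier := {y | ∀ e : ExtBimodule k C,
        MulOpposite.op (TrivSqZeroExt.inr e : RelationExtension k C) • y = 0}
      zero_mem' := fun e => smul_zero _
      add_mem' := fun {x y} hx hy e => by rw [smul_add, hx, hy, add_zero]
      smul_mem' := fun b y hy e => by
        have : MulOpposite.op (TrivSqZeroExt.inr e : RelationExtension k C) * b =
            MulOpposite.op (TrivSqZeroExt.inr (b.unop.fst • e) : RelationExtension k C) := by
          apply MulOpposite.unop_injective
          ext <;> simp
        rw [← mul_smul, this, hy] }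
  have hN : ∀ y, y ∈ N → ∀ e : ExtBimodule k C,
      MulOpposite.op (TrivSqZeroExt.inr e : RelationExtension k C) • y = 0 := fun y hy => hy
  rcases eq_bot_or_eq_top N with h | h
  · intro y e
    have : MulOpposite.op (TrivSqZeroExt.inr e : RelationExtension k C) • y ∈ N := fun e' => by
      rw [← mul_smul, ← MulOpposite.op_mul, TrivSqZeroExt.inr_mul_inr, MulOpposite.op_zero,
        zero_smul]
    rwa [h, Submodule.mem_bot] at this
  · exact fun y e => hN y (h ▸ Submodule.mem_top) e

theorem isSimpleModule_inflation_iff (X : RightMod C) :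
    IsSimpleModule (RelationExtension k C)ᵐᵒᵖ ((inflation k C).obj X) ↔
      IsSimpleModule Cᵐᵒᵖ X := by
  let σ := RingHom.op (TrivSqZeroExt.fstHom k C (ExtBimodule k C)).toRingHom
  have : RingHomSurjective σ :=
    ⟨fun c => ⟨MulOpposite.op (TrivSqZeroExt.inl c.unop), rfl⟩⟩
  let l : (inflation k C).obj X →ₛₗ[σ] X :=
    { toFun := fun x => x
      map_add' := fun _ _ => rfl
      map_smul' := fun _ _ => rfl }
  exact LinearMap.isSimpleModule_iff_of_bijective l Function.bijective_id

theorem indecomposable_of_iso {D : Type*} [Category D] [Limits.HasZeroMorphisms D]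
    [Limits.HasBinaryBiproducts D] {X Y : D} (e : X ≅ Y) (h : Indecomposable X) :
    Indecomposable Y :=
  ⟨fun hY => h.1 (hY.of_iso e), fun Z W i => h.2 Z W (e ≪≫ i)⟩

/-- Inflation is fully faithful, and summands of a module killed by `E` are again killed by `E`, so
decompositions over `B` come from decompositions over `C`. -/
theorem indecomposable_inflation_iff (X : RightMod C) :
    Indecomposable ((inflation k C).obj X) ↔ Indecomposable X := by
  have : Limits.PreservesBinaryBiproducts (inflation k C) :=
    Limits.preservesBinaryBiproducts_of_preservesBiproducts _
  constructor
  · intro h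
    refine ⟨fun hX => h.1 ((isZero_inflation_iff X).2 hX), fun Y Z e => ?_⟩
    rcases h.2 _ _ ((inflation k C).mapIso e ≪≫ (inflation k C).mapBiprod Y Z) with h | h
    · exact Or.inl ((isZero_inflation_iff Y).1 h)
    · exact Or.inr ((isZero_inflation_iff Z).1 h)
  · intro h
    refine ⟨fun hX => h.1 ((isZero_inflation_iff X).1 hX), fun Y Z e => ?_⟩
    have hY : IsKilled Y := (isKilled_inflation X).of_retract
      ⟨Limits.biprod.inl ≫ e.inv, e.hom ≫ Limits.biprod.fst, by simp⟩
    have hZ : IsKilled Z := (isKilled_inflation X).of_retract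
      ⟨Limits.biprod.inr ≫ e.inv, e.hom ≫ Limits.biprod.snd, by simp⟩
    obtain ⟨Y', ⟨eY⟩⟩ := hY.exists_iso
    obtain ⟨Z', ⟨eZ⟩⟩ := hZ.exists_iso
    have e' : X ≅ Y' ⊞ Z' := (inflation k C).preimageIso
      (e ≪≫ (Limits.biprod.mapIso eY eZ).symm ≪≫ ((inflation k C).mapBiprod Y' Z').symm)
    rcases h.2 _ _ e' with h | h
    · exact Or.inl (((isZero_inflation_iff Y').2 h).of_iso eY.symm)
    · exact Or.inr (((isZero_inflation_iff Z').2 h).of_iso eZ.symm)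

/-- Inflation on isomorphism classes. -/
def inflationClass (k : Type u) [Field k] (C : Type u) [Ring C] [Algebra k C] :
    Quotient (isIsomorphicSetoid (RightMod C)) →
      Quotient (isIsomorphicSetoid (RightMod (RelationExtension k C))) :=
  Quotient.map (inflation k C).obj fun _ _ ⟨e⟩ => ⟨(inflation k C).mapIso e⟩

theorem inflationClass_injective : Function.Injective (inflationClass k C) := by
  rintro ⟨X⟩ ⟨Y⟩ h
  obtain ⟨e⟩ := Quotient.exact h
  exact Quotient.sound ⟨(inflation k C).preimageIso e⟩

theorem image_indecomposableSummands (M : RightMod C) :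
    indecomposableSummands ((inflation k C).obj M) =
      inflationClass k C '' indecomposableSummands M := by
  ext c
  constructor
  · rintro ⟨Y, hY, ⟨r⟩, rfl⟩
    obtain ⟨X, ⟨e⟩⟩ := ((isKilled_inflation M).of_retract r).exists_iso
    let s : Retract ((inflation k C).obj X) ((inflation k C).obj M) := (Retract.ofIso e).trans r
    refine ⟨Quotient.mk _ X, ⟨X, (indecomposable_inflation_iff (k := k) X).1
      (indecomposable_of_iso e.symm hY), ⟨⟨(inflation k C).preimage s.i,
        (inflation k C).preimage s.r, (inflation k C).map_injective ?_⟩⟩, rfl⟩,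
      Quotient.sound ⟨e⟩⟩
    rw [Functor.map_comp, Functor.map_preimage, Functor.map_preimage, s.retract,
      CategoryTheory.Functor.map_id]
  · rintro ⟨_, ⟨X, hX, ⟨r⟩, rfl⟩, rfl⟩
    exact ⟨(inflation k C).obj X, (indecomposable_inflation_iff X).2 hX,
      ⟨r.map (inflation k C)⟩, rfl⟩

theorem image_simpleClasses :
    simpleClasses (RelationExtension k C) = inflationClass k C '' simpleClasses C := by
  ext c
  constructor
  · rintro ⟨Y, hY, rfl⟩
    obtain ⟨X, ⟨e⟩⟩ := (isKilled_of_isSimpleModule Y).exists_iso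
    exact ⟨Quotient.mk _ X, ⟨X, (isSimpleModule_inflation_iff (k := k) X).1
      (IsSimpleModule.congr e.toLinearEquiv), rfl⟩, Quotient.sound ⟨e⟩⟩
  · rintro ⟨_, ⟨X, hX, rfl⟩, rfl⟩
    exact ⟨(inflation k C).obj X, (isSimpleModule_inflation_iff X).2 hX, rfl⟩

end InflationClasses

/-! ### The equivalence -/

theorem isTauTilting_inflation_iff (k : Type u) [Field k] (C : Type u) [Ring C] [Algebra k C]
    [FiniteDimensional k C] (hC : globalDimension C = 2) (M : RightMod C) (hM : IsTilting M) :
    IsTauTilting k ((inflation k C).obj M) ↔ injectiveDimension M ≤ 1 := by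
  have := hM.finite
  rw [injectiveDimension_le_one_iff k hC M]
  constructor
  · intro h
    exact subsingleton_ext_two_of_isTauRigid hC M
      (hM.generates k (subsingleton_of_forall_eq_zero fun e => e.eq_zero_of_injective)) h.tauRigid
  · intro h
    refine ⟨finite_inflation M, isTauRigid_inflation hC M h fun X q hq =>
      hM.subsingleton_ext_one ⟨1, powerProj M 1 0 ≫ q, hq.comp fun x => ⟨fun _ => x, rfl⟩⟩, ?_⟩
    rw [image_indecomposableSummands, image_simpleClasses,
      inflationClass_injective.encard_image, inflationClass_injective.encard_image]
    exact le_antisymm (encard_indecomposableSummands_le k hM.toIsPartialTilting)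
      (hM.encard_simpleClasses_le k hC)

end TauTilting

end

theorem corollary3p7 (k : Type u) [Field k] [IsAlgClosed k]
    (C : Type u) [Ring C] [Algebra k C] [FiniteDimensional k C]
    (hC : TauTilting.globalDimension C = 2)
    (M : TauTilting.RightMod C) (hM : TauTilting.IsTilting M) :
    TauTilting.IsTauTilting k ((TauTilting.inflation k C).obj M) ↔
      injectiveDimension M ≤ 1 :=
  TauTilting.isTauTilting_inflation_iff k C hC M hM
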